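/- Let $d\ge 0$, $N\ge 2$, $\ell\ge 1$ be integers and $0<r<1$. For $1\le i\le \ell$ let $K_i\subset\mathbb R^d$ be the self-similar set (the nonempty compact set with $K_i=\bigcup_{k=1}^N S^{(i)}_k(K_i)$) generated by similitudes $S^{(i)}_k(x)=rR^{(i)}_kx+b^{(i)}_k$, $1\le k\le N$, with $R^{(i)}_k$ orthogonal and $b^{(i)}_k\in\mathbb R^d$; the numbers $N$ and $r$ are the same for all $i$. Write $\Sigma=\{1,\dots,N\}$, and for a word $\mathbf u=u_1\cdots u_n\in\Sigma^n$ and $J\subset\mathbb R^d$ put $S^{(i)}_{\mathbf u}=S^{(i)}_{u_1}\circ\dots\circ S^{(i)}_{u_n}$ and $(K_i)_{\mathbf u}=S^{(i)}_{\mathbf u}(K_i)$. *Augmented trees.* An augmented tree is a rooted tree together with a set of horizontal edges: each joins two distinct vertices $x,y$ of the same level, and the predecessors of $x$ and $y$ are equal or again joined by a horizontal edge. A horizontal component $T$ is a maximal subset of a level that is connected through horizontal edges, and $T_{\mathcal D}$ is the set of the descendants of the vertices of $T$ ($T$ included). Two horizontal components $T,T'$ are equivalent if there is a bijection $T_{\mathcal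 D}\to T'_{\mathcal D}$ that, together with its inverse, preserves vertical edges (from a vertex to its offspring) and horizontal edges. The augmented tree is simple if there are only finitely many equivalence classes of horizontal components. The augmented tree of $K_i$ is the tree $\bigcup_{n\ge0}\Sigma^n$ of words (the predecessor of a word is obtained by deleting its last letter), with a horizontal edge between distinct $\mathbf u,\mathbf v$ of the same length whenever $(K_i)_{\mathbf u}\cap(K_i)_{\mathbf v}\ne\emptyset$. The union augmented tree of $K_1,\dots,K_\ell$ is the tree $\{o\}\cup\bigcup_{n\ge0}\{1,\dots,\ell\}\Sigma^n$, whose root $o$ has the offspring $1,\dots,\ell$, with a horizontal edge between distinct vertices $i\mathbf u$, $j\mathbf v$ with $|\mathbf u|=|\mathbf v|$ whenever $(K_i)_{\mathbf u}\cap(K_j)_{\mathbf v}\neq\emptyset$. Suppose that 1. each $K_i$ satisfies condition (H): there are a nonempty bounded closed set $J\subset\mathbb R^d$ with $S^{(i)}_k(J)\subset J$ for all $k$ and a constant $c>0$ such that for all $n\ge1$ and $\mathbf u,\mathbf v\in\Sigma^n$, if $S^{(i)}_{\mathbf u}(J)\cap S^{(i)}_{\mathbf v}(J)=\emptyset$,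 then $\operatorname{dist}(S^{(i)}_{\mathbf u}(J),S^{(i)}_{\mathbf v}(J))\ge cr^n$; 2. the augmented tree of each $K_i$ is simple; 3. the union satisfies condition (H): there is $c>0$ such that for all $n\ge 1$, all $i,j\in\{1,\dots,\ell\}$ (possibly equal) and all $\mathbf u,\mathbf v\in\Sigma^n$, if $(K_i)_{\mathbf u}\cap(K_j)_{\mathbf v}=\emptyset$, then $\operatorname{dist}((K_i)_{\mathbf u},(K_j)_{\mathbf v})\ge cr^n$; 4. the union augmented tree of $K_1,\dots,K_\ell$ is simple. Then $\bigcup_{i=1}^\ell K_i$ is Lipschitz equivalent to $K_j$ for every $j\in\{1,\dots,\ell\}$, that is, there are a bijection $\sigma:\bigcup_{i=1}^\ell K_i\to K_j$ and a constant $C>0$ with $C^{-1}|x-y|\le|\sigma(x)-\sigma(y)|\le C|x-y|$ for all $x,y\in\bigcup_{i=1}^\ell K_i$. -/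

import Mathlib

/-- A rooted tree on the vertex set `V` (given by its root, its predecessor map and the distance
`|x|` of a vertex to the root) with additional horizontal edges: a symmetric, irreflexive relation
that only joins vertices `x`, `y` of the same level, such that the predecessors of `x` and `y` are
equal or again joined by a horizontal edge. The predecessor of the root is set to be the root; this
is only a convention, see `IsVerticalEdge`. -/
structure AugmentedTree (V : Type) where
  root : V
  pred : V → V
  level : V → ℕ
  pred_root : pred root = root
  level_root : level root = 0
  level_eq : ∀ x, x ≠ root → level x = level (pred x) + 1
  horiz : SimpleGraph V
  horiz_level : ∀ x y, horiz.Adj x y → level x = level y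
  horiz_pred : ∀ x y, horiz.Adj x y → pred x = pred y ∨ horiz.Adj (pred x) (pred y)

namespace AugmentedTree

variable {V : Type} (X : AugmentedTree V)

/-- The vertical edge from `x` to its offspring `y`. -/
def IsVerticalEdge (x y : V) : Prop := y ≠ X.root ∧ X.pred y = x

/-- The set of horizontal components of all levels. Horizontal edges join only vertices of the same
level, so the maximal horizontally connected subsets of the levels are exactly the connected
components of the graph of horizontal edges. -/
abbrev HorizontalComponent : Type := X.horiz.ConnectedComponent

/-- The set of descendants of a horizontal component `T`, including `T` itself. -/
def descendants (T : X.HorizontalComponent) : Set V := {x | ∃ k : ℕ, X.pred^[k] x ∈ T.supp}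

/-- Two horizontal components are equivalent if there is a bijection between their sets of
descendants which, together with its inverse, preserves the vertical edges and the horizontal
edges. -/
def Equivalent (T T' : X.HorizontalComponent) : Prop :=
  ∃ g : X.descendants T ≃ X.descendants T',
    (∀ x y : X.descendants T, X.IsVerticalEdge (x : V) (y : V) ↔ X.IsVerticalEdge (g x : V) (g y : V)) ∧
    (∀ x y : X.descendants T, X.horiz.Adj (x : V) (y : V) ↔ X.horiz.Adj (g x : V) (g y : V))

/-- Equivalence of horizontal components as a setoid. -/
def componentSetoid : Setoid X.HorizontalComponent where
  r := X.Equivalent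
  iseqv :=
    { refl := fun _ => ⟨Equiv.refl _, fun _ _ => Iff.rfl, fun _ _ => Iff.rfl⟩
      symm := by
        rintro T T' ⟨g, hv, hh⟩
        refine ⟨g.symm, fun x y => ?_, fun x y => ?_⟩
        · simpa using (hv (g.symm x) (g.symm y)).symm
        · simpa using (hh (g.symm x) (g.symm y)).symm
      trans := by
        rintro T T' T'' ⟨g, hv, hh⟩ ⟨g', hv', hh'⟩
        exact ⟨g.trans g', fun x y => (hv x y).trans (hv' _ _),
          fun x y => (hh x y).trans (hh' _ _)⟩ }

/-- An augmented tree is simple if there are only finitely many equivalence classes of horizontal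
components. -/
def IsSimple : Prop := Finite (Quotient X.componentSetoid)

end AugmentedTree

/-- An iterated function system on `ℝ^d` of `N` similitudes `S_j(x) = r R_j x + b_j` with the common
ratio `r`, where the `R_j` are orthogonal. -/
structure SimilarIFS (d N : ℕ) (r : ℝ) where
  rot : Fin N → (EuclideanSpace ℝ (Fin d) ≃ₗᵢ[ℝ] EuclideanSpace ℝ (Fin d))
  trans : Fin N → EuclideanSpace ℝ (Fin d)

namespace SimilarIFS

variable {d N : ℕ} {r : ℝ} (S : SimilarIFS d N r)

/-- The similitude `S_j`. -/
noncomputable def map (j : Fin N) (x : EuclideanSpace ℝ (Fin d)) : EuclideanSpace ℝ (Fin d) :=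
  r • S.rot j x + S.trans j

/-- The composition `S_w = S_{w₁} ∘ ⋯ ∘ S_{wₙ}` along a word `w = w₁ ⋯ wₙ`. -/
noncomputable def wordMap : List (Fin N) → EuclideanSpace ℝ (Fin d) → EuclideanSpace ℝ (Fin d)
  | [] => id
  | j :: w => S.map j ∘ wordMap w

/-- The cell `J_w = S_w(J)`. -/
def cell (J : Set (EuclideanSpace ℝ (Fin d))) (w : List (Fin N)) :
    Set (EuclideanSpace ℝ (Fin d)) := S.wordMap w '' J

/-- `K` is the self-similar set generated by the iterated function system: the nonempty compact set
with `K = S_1(K) ∪ ⋯ ∪ S_N(K)` (which is unique when `0 < r < 1`). -/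
structure IsSelfSimilarSet (K : Set (EuclideanSpace ℝ (Fin d))) : Prop where
  nonempty : K.Nonempty
  isCompact : IsCompact K
  eq_iUnion : K = ⋃ j, S.map j '' K

/-- Condition (H): there are a nonempty bounded closed invariant set `J` and `c > 0` such that
any two disjoint cells `J_u`, `J_v` of a level `n ≥ 1` have distance at least `c * r ^ n`. -/
def ConditionH : Prop :=
  ∃ J : Set (EuclideanSpace ℝ (Fin d)), J.Nonempty ∧ Bornology.IsBounded J ∧ IsClosed J ∧
    (∀ j, S.map j '' J ⊆ J) ∧
    ∃ c : ℝ, 0 < c ∧ ∀ n : ℕ, 1 ≤ n → ∀ u v : List (Fin N), u.length = n → v.length = n →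
      Disjoint (S.cell J u) (S.cell J v) →
      ∀ x ∈ S.cell J u, ∀ y ∈ S.cell J v, c * r ^ n ≤ dist x y

variable {S} {K : Set (EuclideanSpace ℝ (Fin d))}

theorem wordMap_append (u v : List (Fin N)) :
    S.wordMap (u ++ v) = S.wordMap u ∘ S.wordMap v := by
  induction u with
  | nil => rfl
  | cons j u ih => simp [wordMap, ih, Function.comp_assoc]

theorem IsSelfSimilarSet.cell_subset (hK : S.IsSelfSimilarSet K) (w : List (Fin N)) :
    S.cell K w ⊆ S.cell K w.dropLast := by
  rcases List.eq_nil_or_concat w with rfl | ⟨u, j, rfl⟩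
  · exact subset_rfl
  · rintro _ ⟨x, hx, rfl⟩
    have hj : S.map j x ∈ K := by
      rw [hK.eq_iUnion]
      exact Set.mem_iUnion.2 ⟨j, x, hx, rfl⟩
    refine ⟨S.map j x, hj, ?_⟩
    simp [wordMap_append, wordMap]

/-- The self-similar augmented tree of `K`: the tree of finite words (the predecessor of a word
drops its last letter), with horizontal edges between different words of equal length whose cells
intersect. -/
def augmentedTree (hK : S.IsSelfSimilarSet K) : AugmentedTree (List (Fin N)) where
  root := []
  pred := List.dropLast
  level := List.length
  pred_root := rfl
  level_root := rfl
  level_eq := fun x hx => by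
    have := List.length_pos_iff.2 hx
    rw [List.length_dropLast]
    omega
  horiz :=
    { Adj := fun u v => u.length = v.length ∧ u ≠ v ∧ (S.cell K u ∩ S.cell K v).Nonempty
      symm := ⟨fun _ _ h => ⟨h.1.symm, h.2.1.symm, by rw [Set.inter_comm]; exact h.2.2⟩⟩
      loopless := ⟨fun _ h => h.2.1 rfl⟩ }
  horiz_level := fun _ _ h => h.1
  horiz_pred := fun u v h => by
    by_cases huv : u.dropLast = v.dropLast
    · exact Or.inl huv
    · refine Or.inr ⟨?_, huv, ?_⟩
      · rw [List.length_dropLast, List.length_dropLast, h.1]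
      · exact h.2.2.mono (Set.inter_subset_inter (hK.cell_subset u) (hK.cell_subset v))

end SimilarIFS

section Union

variable {d N l : ℕ} {r : ℝ} {S : Fin l → SimilarIFS d N r}
  {K : Fin l → Set (EuclideanSpace ℝ (Fin d))}

/-- Predecessors in the tree `{o} ∪ {i w : 1 ≤ i ≤ l, w a finite word}`; `none` is the root `o` and
`some (i, w)` is the vertex `i w`. -/
def unionPred : Option (Fin l × List (Fin N)) → Option (Fin l × List (Fin N))
  | none => none
  | some (_, []) => none
  | some (i, j :: w) => some (i, (j :: w).dropLast)

/-- Levels in the tree `{o} ∪ {i w : 1 ≤ i ≤ l, w a finite word}`. -/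
def unionLevel : Option (Fin l × List (Fin N)) → ℕ
  | none => 0
  | some (_, w) => w.length + 1

/-- The union augmented tree of `K_1, …, K_l`: the tree `{o} ∪ {i w : 1 ≤ i ≤ l, w a finite word}`
with horizontal edges between different vertices `i u` and `j v` such that `u` and `v` have equal
length and the cells `(K_i)_u` and `(K_j)_v` intersect. -/
def unionAugmentedTree (hK : ∀ i, (S i).IsSelfSimilarSet (K i)) :
    AugmentedTree (Option (Fin l × List (Fin N))) where
  root := none
  pred := unionPred
  level := unionLevel
  pred_root := rfl
  level_root := rfl
  level_eq := fun x hx => by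
    rcases x with _ | ⟨i, _ | ⟨j, w⟩⟩
    · exact absurd rfl hx
    · rfl
    · simp [unionPred, unionLevel]
  horiz :=
    { Adj := fun x y => ∃ i u j v, x = some (i, u) ∧ y = some (j, v) ∧ u.length = v.length ∧
        x ≠ y ∧ ((S i).cell (K i) u ∩ (S j).cell (K j) v).Nonempty
      symm := ⟨by
        rintro _ _ ⟨i, u, j, v, rfl, rfl, hl, hne, hi⟩
        exact ⟨j, v, i, u, rfl, rfl, hl.symm, hne.symm, by rw [Set.inter_comm]; exact hi⟩⟩
      loopless := ⟨by
        rintro _ ⟨i, u, j, v, rfl, _, _, hne, _⟩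
        exact hne rfl⟩ }
  horiz_level := by
    rintro _ _ ⟨i, u, j, v, rfl, rfl, hl, _, _⟩
    simp [unionLevel, hl]
  horiz_pred := by
    rintro _ _ ⟨i, u, j, v, rfl, rfl, hl, hne, hi⟩
    by_cases h : unionPred (some (i, u)) = unionPred (some (j, v))
    · exact Or.inl h
    · refine Or.inr ?_
      rcases u with _ | ⟨a, u⟩ <;> rcases v with _ | ⟨b, v⟩
      · exact absurd rfl h
      · simp at hl
      · simp at hl
      · refine ⟨i, (a :: u).dropLast, j, (b :: v).dropLast, rfl, rfl, ?_, h, ?_⟩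
        · rw [List.length_dropLast, List.length_dropLast, hl]
        · exact hi.mono (Set.inter_subset_inter ((hK i).cell_subset _) ((hK j).cell_subset _))

/-- Condition (H) for the union `K_1 ∪ ⋯ ∪ K_l`: there is `c > 0` such that any two disjoint cells
`(K_i)_u`, `(K_j)_v` (with `i = j` allowed) of a level `n ≥ 1` have distance at least
`c * r ^ n`. -/
def UnionConditionH (S : Fin l → SimilarIFS d N r)
    (K : Fin l → Set (EuclideanSpace ℝ (Fin d))) : Prop :=
  ∃ c : ℝ, 0 < c ∧ ∀ n : ℕ, 1 ≤ n → ∀ i j : Fin l, ∀ u v : List (Fin N),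
    u.length = n → v.length = n →
    Disjoint ((S i).cell (K i) u) ((S j).cell (K j) v) →
    ∀ x ∈ (S i).cell (K i) u, ∀ y ∈ (S j).cell (K j) v, c * r ^ n ≤ dist x y

end Union

/-- Lipschitz equivalence of two subsets of a metric space: there is a bi-Lipschitz bijection of one
onto the other. -/
def LipschitzEquivalent {E : Type} [MetricSpace E] (A B : Set E) : Prop :=
  ∃ σ : A → B, Function.Bijective σ ∧ ∃ C : ℝ, 0 < C ∧ ∀ x y : A,
    C⁻¹ * dist x y ≤ dist (σ x) (σ y) ∧ dist (σ x) (σ y) ≤ C * dist x y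

/-! ### Filtered sets up to bounded level shifts, and codings by words -/

/-- A set filtered by a decreasing sequence of relations (being close up to level `n`). -/
structure FilteredSet where
  carrier : Type
  rel : ℕ → carrier → carrier → Prop
  anti : ∀ {m n : ℕ}, m ≤ n → ∀ {x y}, rel n x y → rel m x y

namespace FilteredSet

/-- `X` and `Y` are related by a bijection that shifts the levels by at most `c`. -/
def ShiftEquiv (c : ℕ) (X Y : FilteredSet) : Prop :=
  ∃ f : X.carrier ≃ Y.carrier, ∀ n x y,
    (X.rel (n + c) x y → Y.rel n (f x) (f y)) ∧ (Y.rel (n + c) (f x) (f y) → X.rel n x y)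

theorem ShiftEquiv.symm {c : ℕ} {X Y : FilteredSet} (h : ShiftEquiv c X Y) :
    ShiftEquiv c Y X := by
  obtain ⟨f, hf⟩ := h
  refine ⟨f.symm, fun n x y => ?_⟩
  have := hf n (f.symm x) (f.symm y)
  simp only [Equiv.apply_symm_apply] at this
  exact ⟨this.2, this.1⟩

theorem ShiftEquiv.trans {c c' : ℕ} {X Y Z : FilteredSet} (h : ShiftEquiv c X Y)
    (h' : ShiftEquiv c' Y Z) : ShiftEquiv (c + c') X Z := by
  obtain ⟨f, hf⟩ := h
  obtain ⟨g, hg⟩ := h'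
  refine ⟨f.trans g, fun n x y => ⟨fun hx => ?_, fun hx => ?_⟩⟩
  · refine (hg n _ _).1 ((hf (n + c') _ _).1 ?_)
    rwa [add_assoc, add_comm c' c]
  · refine (hf n _ _).2 ((hg (n + c) _ _).2 ?_)
    rwa [add_assoc]

theorem ShiftEquiv.mono {c c' : ℕ} {X Y : FilteredSet} (h : ShiftEquiv c X Y) (hc : c ≤ c') :
    ShiftEquiv c' X Y := by
  obtain ⟨f, hf⟩ := h
  exact ⟨f, fun n x y => ⟨fun hx => (hf n x y).1 (X.anti (by omega) hx),
    fun hx => (hf n x y).2 (Y.anti (by omega) hx)⟩⟩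

/-- `k` copies of the space of infinite words over an alphabet of `N` letters. -/
def words (N k : ℕ) : FilteredSet where
  carrier := Fin k × (ℕ → Fin N)
  rel n x y := x.1 = y.1 ∧ ∀ i < n, x.2 i = y.2 i
  anti hmn _ _ h := ⟨h.1, fun i hi => h.2 i (hi.trans_le hmn)⟩

/-- The infinite paths that start in `s` and proceed along the offspring map `ch`. -/
def IsPath {V : Type} (ch : V → Finset V) (s : Set V) (p : ℕ → V) : Prop :=
  p 0 ∈ s ∧ ∀ n, p (n + 1) ∈ ch (p n)

/-- The space of infinite paths that start in `s`. -/
def paths {V : Type} (ch : V → Finset V) (s : Set V) : FilteredSet where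
  carrier := {p : ℕ → V // IsPath ch s p}
  rel n p q := ∀ i ≤ n, p.1 i = q.1 i
  anti hmn _ _ h := fun i hi => h i (hi.trans hmn)

/-- A coding of the infinite paths that start in `s` by the elements of `words N k`: the functions
`A` and `D` give the copy and the digits, `G` is the inverse map. -/
structure IsCoding {V : Type} (ch : V → Finset V) (s : Set V) (N k c : ℕ)
    (A : (ℕ → V) → ℕ) (D : (ℕ → V) → ℕ → Fin N) (G : ℕ → (ℕ → Fin N) → ℕ → V) : Prop where
  lt : ∀ p, IsPath ch s p → A p < k
  left_inv : ∀ p, IsPath ch s p → G (A p) (D p) = p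
  isPath : ∀ a < k, ∀ d, IsPath ch s (G a d)
  copy_eq : ∀ a < k, ∀ d, A (G a d) = a
  digit_eq : ∀ a < k, ∀ d, D (G a d) = d
  copy_congr : ∀ p q, IsPath ch s p → IsPath ch s q → (∀ i ≤ c, p i = q i) → A p = A q
  digit_congr : ∀ n p q, IsPath ch s p → IsPath ch s q → (∀ i ≤ n + 1 + c, p i = q i) →
    D p n = D q n
  path_congr : ∀ n, ∀ a < k, ∀ d e, (∀ i < n + c, d i = e i) → G a d n = G a e n

theorem IsCoding.shiftEquiv {V : Type} {ch : V → Finset V} {s : Set V} {N k c : ℕ}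
    {A : (ℕ → V) → ℕ} {D : (ℕ → V) → ℕ → Fin N} {G : ℕ → (ℕ → Fin N) → ℕ → V}
    (h : IsCoding ch s N k c A D G) : ShiftEquiv c (paths ch s) (words N k) := by
  let f : (paths ch s).carrier ≃ (words N k).carrier :=
    { toFun := fun p => (⟨A p.1, h.lt _ p.2⟩, D p.1)
      invFun := fun x => ⟨G x.1 x.2, h.isPath _ x.1.2 _⟩
      left_inv := fun p => Subtype.ext (h.left_inv _ p.2)
      right_inv := fun x => Prod.ext (Fin.ext (h.copy_eq _ x.1.2 _)) (h.digit_eq _ x.1.2 _) }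
  refine ⟨f, fun n p q => ⟨fun hpq => ⟨Fin.ext ?_, fun i hi => ?_⟩, fun hpq i hi => ?_⟩⟩
  · exact h.copy_congr _ _ p.2 q.2 fun i hi => hpq i (by omega)
  · exact h.digit_congr i _ _ p.2 q.2 fun j hj => hpq j (by omega)
  · have h1 : A p.1 = A q.1 := congrArg Fin.val hpq.1
    rw [← h.left_inv _ p.2, ← h.left_inv _ q.2, h1]
    exact h.path_congr i _ (h.lt _ q.2) _ _ fun j hj => hpq.2 j (by omega)

/-- Total functions on all sequences allow codings from different start vertices to be glued without
dependent types. The default values off paths and for copies `a ≥ k` play no role. -/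
theorem ShiftEquiv.exists_isCoding {V : Type} {ch : V → Finset V} {s : Set V} {N k c : ℕ}
    (h : ShiftEquiv c (paths ch s) (words N k)) (hN : 0 < N) (hs : s.Nonempty) :
    ∃ A D G, IsCoding ch s N k c A D G := by
  classical
  obtain ⟨f, hf⟩ : ∃ f : {p // IsPath ch s p} ≃ Fin k × (ℕ → Fin N),
    ∀ (n : ℕ) (x y : {p // IsPath ch s p}), ((∀ i ≤ n + c, x.1 i = y.1 i) →
      (f x).1 = (f y).1 ∧ ∀ i < n, (f x).2 i = (f y).2 i) ∧
    (((f x).1 = (f y).1 ∧ ∀ i < n + c, (f x).2 i = (f y).2 i) → ∀ i ≤ n, x.1 i = y.1 i) := h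
  obtain ⟨v, -⟩ := hs
  refine ⟨fun p => if hp : IsPath ch s p then (f ⟨p, hp⟩).1 else 0,
    fun p => if hp : IsPath ch s p then (f ⟨p, hp⟩).2 else fun _ => ⟨0, hN⟩,
    fun a d => if ha : a < k then (f.symm (⟨a, ha⟩, d)).1 else fun _ => v, ?_⟩
  have hG : ∀ a (ha : a < k) d, IsPath ch s (f.symm (⟨a, ha⟩, d)).1 := fun a ha d =>
    (f.symm (⟨a, ha⟩, d)).2
  constructor
  · intro p hp
    simp [hp]
  · intro p hp
    simp [hp]
  · intro a ha d
    simpa [ha] using hG a ha d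
  · intro a ha d
    simp [ha, hG]
  · intro a ha d
    simp [ha, hG]
  · intro p q hp hq hpq
    have := ((hf 0 ⟨p, hp⟩ ⟨q, hq⟩).1 fun i hi => hpq i (by omega)).1
    simp [hp, hq, this]
  · intro n p q hp hq hpq
    have := ((hf (n + 1) ⟨p, hp⟩ ⟨q, hq⟩).1 fun i hi => hpq i (by omega)).2 n (by omega)
    simpa [hp, hq] using this
  · intro n a ha d e hde
    have := (hf n (f.symm (⟨a, ha⟩, d)) (f.symm (⟨a, ha⟩, e))).2
      (by simp only [Equiv.apply_symm_apply]; exact ⟨trivial, hde⟩) n le_rfl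
    simpa [ha] using this

/-! ### Several copies of the word space are equivalent to one -/

section Swindle

variable {N : ℕ} (k : ℕ)

/-- The copy of `words N k` in which the image of the word `x` lies. -/
def splitCopy (x : ℕ → Fin N) : ℕ := if (x 0 : ℕ) < k then x 0 else 0

/-- The digits of the image of the word `x` in `words N k`. -/
def splitDigit (hk : k ≤ N) : ℕ → (ℕ → Fin N) → Fin N
  | 0, x => if (x 0 : ℕ) = 0 then
      (if (x 1 : ℕ) < k then x 1 else ⟨0, (x 0).pos⟩) else if (x 0 : ℕ) < k then x 1 else x 0
  | n + 1, x => if (x 0 : ℕ) = 0 then splitDigit hk n (fun i => x (i + 1))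
      else if (x 0 : ℕ) < k then x (n + 2) else x (n + 1)

/-- The inverse of the map given by `splitCopy` and `splitDigit`. -/
def mergeDigit (hN : 0 < N) : ℕ → ℕ → (ℕ → Fin N) → Fin N
  | 0, a, y => if h : 0 < a ∧ a < N then ⟨a, h.2⟩ else if k ≤ (y 0 : ℕ) then y 0 else ⟨0, hN⟩
  | n + 1, a, y => if 0 < a then y n else if k ≤ (y 0 : ℕ) then y (n + 1) else
      mergeDigit hN n (y 0) (fun i => y (i + 1))

variable {k}

theorem splitCopy_lt (hk0 : 0 < k) (x : ℕ → Fin N) : splitCopy k x < k := by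
  unfold splitCopy; split_ifs <;> omega

/-- The word space is the disjoint union of its `N` first-letter pieces. The pieces of the letters
`1, …, k - 1` become the copies with these numbers, and the pieces of the letters `≥ k` stay in
place inside copy 0. The piece of the letter 0 must then supply the `k` missing pieces of copy 0,
which is the original problem for the tail; hence the recursion. -/
theorem mergeDigit_split (hN : 0 < N) (hk : k ≤ N) (hk0 : 0 < k) (n : ℕ) (x : ℕ → Fin N) :
    mergeDigit k hN n (splitCopy k x) (fun i => splitDigit k hk i x) = x n := by
  induction n generalizing x with
  | zero =>
    by_cases h0 : (x 0 : ℕ) = 0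
    · have : ¬ (k ≤ ((if (x 1 : ℕ) < k then x 1 else ⟨0, (x 0).pos⟩ : Fin N) : ℕ)) := by
        split_ifs <;> simp <;> omega
      simp only [mergeDigit, splitCopy, splitDigit, h0, if_true, this, if_false]
      apply Fin.ext
      simp [hk0, h0]
    · by_cases h1 : (x 0 : ℕ) < k
      · simp [mergeDigit, splitCopy, h1, Nat.pos_of_ne_zero h0]
      · simp [mergeDigit, splitCopy, splitDigit, h0, h1, not_lt.1 h1]
  | succ n ih =>
    by_cases h0 : (x 0 : ℕ) = 0
    · have h2 : ¬ (k ≤ ((if (x 1 : ℕ) < k then x 1 else ⟨0, (x 0).pos⟩ : Fin N) : ℕ)) := by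
        split_ifs <;> simp <;> omega
      have h3 := ih (fun i => x (i + 1))
      have h4 : ((if (x 1 : ℕ) < k then x 1 else ⟨0, (x 0).pos⟩ : Fin N) : ℕ) =
          splitCopy k fun i => x (i + 1) := by
        simp only [splitCopy]; split_ifs <;> rfl
      have h5 : splitCopy k x = 0 := by simp [splitCopy, h0]
      rw [h4] at h2
      simp only [mergeDigit, splitDigit, h0, if_true, h4]
      simp [h5, h3, h2]
    · by_cases h1 : (x 0 : ℕ) < k
      · cases n <;> simp [mergeDigit, splitCopy, splitDigit, h0, h1, Nat.pos_of_ne_zero h0]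
      · simp [mergeDigit, splitCopy, splitDigit, h0, h1, not_lt.1 h1]

theorem splitCopy_merge (hN : 0 < N) (hk : k ≤ N) (a : ℕ) (ha : a < k) (y : ℕ → Fin N) :
    splitCopy k (fun i => mergeDigit k hN i a y) = a := by
  by_cases h0 : 0 < a
  · simp [splitCopy, mergeDigit, h0, ha.trans_le hk, ha]
  · obtain rfl : a = 0 := by omega
    simp only [splitCopy, mergeDigit]
    by_cases h : k ≤ (y 0 : ℕ) <;> simp [h]

theorem splitDigit_merge (hN : 0 < N) (hk : k ≤ N) (n a : ℕ) (ha : a < k) (y : ℕ → Fin N) :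
    splitDigit k hk n (fun i => mergeDigit k hN i a y) = y n := by
  induction n generalizing a y with
  | zero =>
    by_cases h0 : 0 < a
    · simp [splitDigit, mergeDigit, h0, h0.ne', ha.trans_le hk, ha]
    · obtain rfl : a = 0 := by omega
      by_cases h : k ≤ (y 0 : ℕ)
      · have : (y 0 : ℕ) ≠ 0 := by omega
        simp [splitDigit, mergeDigit, h, this, not_lt.2 h]
      · have h1 := splitCopy_merge hN hk (y 0) (not_le.1 h) (fun i => y (i + 1))
        simp only [splitDigit, mergeDigit, h, splitCopy] at h1 ⊢
        apply Fin.ext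
        simp only [lt_self_iff_false, false_and, dite_false, if_false, if_true]
        rw [apply_ite Fin.val]
        exact h1
  | succ n ih =>
    by_cases h0 : 0 < a
    · simp [splitDigit, mergeDigit, h0, h0.ne', ha.trans_le hk, ha]
    · obtain rfl : a = 0 := by omega
      by_cases h : k ≤ (y 0 : ℕ)
      · have : (y 0 : ℕ) ≠ 0 := by omega
        simp [splitDigit, mergeDigit, h, this, not_lt.2 h]
      · have h1 := ih (y 0) (not_le.1 h) (fun i => y (i + 1))
        simpa [splitDigit, mergeDigit, h] using h1

/-- One letter of lookahead suffices: after a letter 0, the next digit is the copy number of the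
tail, which is read off from the first letter of the tail. -/
theorem splitDigit_congr (hk : k ≤ N) (n : ℕ) (x y : ℕ → Fin N) (h : ∀ i ≤ n + 1, x i = y i) :
    splitDigit k hk n x = splitDigit k hk n y := by
  induction n generalizing x y with
  | zero => simp only [splitDigit, h 0 (by omega), h 1 (by omega)]
  | succ n ih =>
    simp only [splitDigit, h 0 (by omega), h (n + 1) (by omega), h (n + 2) (by omega)]
    rw [ih (fun i => x (i + 1)) (fun i => y (i + 1)) fun i hi => h (i + 1) (by omega)]

theorem mergeDigit_congr (hN : 0 < N) (n a : ℕ) (x y : ℕ → Fin N) (h : ∀ i ≤ n, x i = y i) :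
    mergeDigit k hN n a x = mergeDigit k hN n a y := by
  induction n generalizing a x y with
  | zero => simp only [mergeDigit, h 0 (by omega)]
  | succ n ih =>
    simp only [mergeDigit, h 0 (by omega), h (n + 1) (by omega), h n (by omega)]
    rw [ih _ (fun i => x (i + 1)) (fun i => y (i + 1)) fun i hi => h (i + 1) (by omega)]

/-- Up to a bounded shift of the levels, `k` copies of the space of words are equivalent to a single
copy. -/
theorem shiftEquiv_words_one (hk0 : 0 < k) (hk : k ≤ N) :
    ShiftEquiv 2 (words N k) (words N 1) := by
  have hN : 0 < N := hk0.trans_le hk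
  refine ShiftEquiv.symm ⟨{
      toFun := fun x => (⟨splitCopy k x.2, splitCopy_lt hk0 _⟩, fun i => splitDigit k hk i x.2)
      invFun := fun x => (0, fun i => mergeDigit k hN i x.1 x.2)
      left_inv := fun x => Prod.ext (Subsingleton.elim _ _)
        (funext fun n => mergeDigit_split hN hk hk0 n x.2)
      right_inv := fun x => Prod.ext (Fin.ext (splitCopy_merge hN hk _ x.1.2 x.2))
        (funext fun n => splitDigit_merge hN hk n _ x.1.2 x.2) }, fun n x y => ⟨?_, ?_⟩⟩
  · rintro ⟨-, h⟩
    refine ⟨Fin.ext ?_, fun i hi => splitDigit_congr hk i _ _ fun j hj => h j (by omega)⟩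
    change splitCopy k x.2 = splitCopy k y.2
    simp only [splitCopy, h 0 (by omega)]
  · rintro ⟨h0, h⟩
    refine ⟨Subsingleton.elim _ _, fun i hi => ?_⟩
    rw [← mergeDigit_split hN hk hk0 i x.2, ← mergeDigit_split hN hk hk0 i y.2]
    rw [show splitCopy k x.2 = splitCopy k y.2 from congrArg Fin.val h0]
    exact mergeDigit_congr hN i _ _ _ fun j hj => h j (by omega)

theorem shiftEquiv_words {k' : ℕ} (hk0 : 0 < k) (hk : k ≤ N) (hk0' : 0 < k') (hk' : k' ≤ N) :
    ShiftEquiv 4 (words N k) (words N k') :=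
  (shiftEquiv_words_one hk0 hk).trans (shiftEquiv_words_one hk0' hk').symm

end Swindle

end FilteredSet

/-! ### Coding paths by packing offspring into groups -/

namespace FilteredSet

section Packing

variable {V : Type} {ch : V → Finset V} {k : V → ℕ} {N : ℕ}

/-- The offspring of `v`, an offspring `u` counted with the multiplicity `k u`, can be divided into
`k v` groups of size `N`. -/
def IsPacking (ch : V → Finset V) (k : V → ℕ) (N : ℕ) (v : V) : Prop :=
  ∃ grp : V → ℕ, (∀ u ∈ ch v, grp u < k v) ∧
    ∀ i < k v, ∑ u ∈ ch v with grp u = i, k u = N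

/-- Group `i` consists of the pairs `(u, b)` with `grp u = i` and `b < k u`. There are exactly `N`
of them, so a numbering lets one digit stand for an offspring together with one of its copies; `dec`
inverts `dig` inside a given group. -/
theorem IsPacking.exists_enumeration {v : V} (h : IsPacking ch k N v) (hN : 0 < N) :
    ∃ (grp : V → ℕ) (dig : V → ℕ → Fin N) (dec : ℕ → Fin N → V × ℕ),
      (∀ u ∈ ch v, grp u < k v) ∧
      (∀ u ∈ ch v, ∀ b < k u, dec (grp u) (dig u b) = (u, b)) ∧
      ∀ a < k v, ∀ d, (dec a d).1 ∈ ch v ∧ (dec a d).2 < k (dec a d).1 ∧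
        grp (dec a d).1 = a ∧ dig (dec a d).1 (dec a d).2 = d := by
  classical
  obtain ⟨grp, hg, hsum⟩ := h
  let T : ℕ → Finset (V × ℕ) := fun i =>
    ((ch v).filter fun u => grp u = i).biUnion fun u => {u} ×ˢ Finset.range (k u)
  have hT : ∀ i x, x ∈ T i ↔ x.1 ∈ ch v ∧ grp x.1 = i ∧ x.2 < k x.1 := by
    rintro i ⟨u, b⟩
    simp only [T, Finset.mem_biUnion, Finset.mem_filter, Finset.mem_product, Finset.mem_singleton,
      Finset.mem_range]
    constructor
    · rintro ⟨u', ⟨h1, h2⟩, rfl, h3⟩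
      exact ⟨h1, h2, h3⟩
    · rintro ⟨h1, h2, h3⟩
      exact ⟨u, ⟨h1, h2⟩, rfl, h3⟩
  have hcard : ∀ i < k v, (T i).card = N := by
    intro i hi
    rw [Finset.card_biUnion]
    · simpa using hsum i hi
    · intro x _ y _ hxy
      rw [Function.onFun, Finset.disjoint_left]
      rintro ⟨u, b⟩ h1 h2
      simp only [Finset.mem_product, Finset.mem_singleton] at h1 h2
      exact hxy (h1.1.symm.trans h2.1)
  let e : ∀ i, i < k v → (T i ≃ Fin N) := fun i hi => (T i).equivFinOfCardEq (hcard i hi)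
  let dig : V → ℕ → Fin N := fun u b =>
    if h : ∃ hi : grp u < k v, (u, b) ∈ T (grp u) then e _ h.1 ⟨(u, b), h.2⟩ else ⟨0, hN⟩
  have hdig : ∀ i (hi : i < k v) u b (hu : (u, b) ∈ T i), dig u b = e i hi ⟨(u, b), hu⟩ := by
    intro i hi u b hu
    obtain rfl := ((hT _ _).1 hu).2.1
    exact dif_pos ⟨hi, hu⟩
  refine ⟨grp, dig, fun a d => if ha : a < k v then ((e a ha).symm d).1 else (v, 0), hg, ?_, ?_⟩
  · intro u hu b hb
    have h2 : (u, b) ∈ T (grp u) := (hT _ _).2 ⟨hu, rfl, hb⟩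
    simp [hg u hu, hdig _ (hg u hu) _ _ h2]
  · intro a ha d
    have h1 := (hT _ _).1 ((e a ha).symm d).2
    simp only [dif_pos ha]
    refine ⟨h1.1, h1.2.2, h1.2.1, ?_⟩
    rw [hdig a ha _ _ ((e a ha).symm d).2]
    simp

variable (I : V → Prop) (grp : V → V → ℕ) (dig : V → V → ℕ → Fin N) (dec : V → ℕ → Fin N → V × ℕ)
  (A : V → (ℕ → V) → ℕ) (D : V → (ℕ → V) → ℕ → Fin N) (G : V → ℕ → (ℕ → Fin N) → ℕ → V)

open Classical in
/-- The copy assigned to a path by packings at the vertices in `I` and codings at other vertices. -/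
noncomputable def glueCopy (p : ℕ → V) : ℕ := if I (p 0) then grp (p 0) (p 1) else A (p 0) p

open Classical in
/-- The digits assigned to a path by packings at the vertices in `I` and codings at other
vertices. -/
noncomputable def glueDigit : ℕ → (ℕ → V) → Fin N
  | 0, p => if I (p 0) then dig (p 0) (p 1) (glueCopy I grp A fun i => p (i + 1)) else D (p 0) p 0
  | n + 1, p => if I (p 0) then glueDigit n (fun i => p (i + 1)) else D (p 0) p (n + 1)

open Classical in
/-- The path with given copy and digits. -/
noncomputable def gluePath : ℕ → V → ℕ → (ℕ → Fin N) → V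
  | 0, v, _, _ => v
  | n + 1, v, a, d => if I v then
      gluePath n (dec v a (d 0)).1 (dec v a (d 0)).2 (fun i => d (i + 1)) else G v a d (n + 1)

variable {I grp dig dec A D G}

theorem IsPath.tail {s : Set V} {p : ℕ → V} (hp : IsPath ch s p) :
    IsPath ch {p 1} fun i => p (i + 1) := ⟨rfl, fun n => hp.2 (n + 1)⟩

/-- At a vertex of `I`, the copy is the group of the next vertex, the first digit records that
vertex and the copy of the tail, and the other digits are those of the tail. Each digit thus
consumes one generation, and a path leaving `I` is taken over by its local coding. The shift
therefore grows by 1 in total, however long the path stays in `I`. -/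
theorem isCoding_glue {c : ℕ} {L : V → Prop}
    (hch : ∀ v, I v → ∀ u ∈ ch v, I u ∨ L u)
    (hgrp : ∀ v, I v → ∀ u ∈ ch v, grp v u < k v)
    (hdec : ∀ v, I v → ∀ u ∈ ch v, ∀ b < k u, dec v (grp v u) (dig v u b) = (u, b))
    (hdig : ∀ v, I v → ∀ a < k v, ∀ d, (dec v a d).1 ∈ ch v ∧ (dec v a d).2 < k (dec v a d).1 ∧
        grp v (dec v a d).1 = a ∧ dig v (dec v a d).1 (dec v a d).2 = d)
    (hL : ∀ v, L v → IsCoding ch {v} N (k v) c (A v) (D v) (G v)) (v : V) (hv : I v ∨ L v) :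
    IsCoding ch {v} N (k v) (c + 1) (glueCopy I grp A)
      (fun p n => glueDigit I grp dig A D n p) (fun a d n => gluePath I dec G n v a d) := by
  classical
  have hA : ∀ v, (I v ∨ L v) → ∀ p, IsPath ch {v} p → glueCopy I grp A p < k v := by
    rintro v hv p hp
    obtain rfl : p 0 = v := hp.1
    by_cases h : I (p 0)
    · simpa [glueCopy, h] using hgrp _ h _ (hp.2 0)
    · simpa [glueCopy, h] using (hL _ (hv.resolve_left h)).lt p hp
  have hnotI : ∀ v, (I v ∨ L v) → ¬ I v → ∀ a < k v, ∀ d,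
      (fun n => gluePath I dec G n v a d) = G v a d := by
    intro v hv h a ha d
    have hc := hL _ (hv.resolve_left h)
    funext n
    cases n with
    | zero => exact (hc.isPath a ha d).1.symm
    | succ n => simp [gluePath, h]
  have hAG : ∀ v, (I v ∨ L v) → ∀ a < k v, ∀ d,
      glueCopy I grp A (fun n => gluePath I dec G n v a d) = a := by
    intro v hv a ha d
    by_cases h : I v
    · simpa [glueCopy, gluePath, h] using (hdig v h a ha (d 0)).2.2.1
    · have hc := hL _ (hv.resolve_left h)
      rw [hnotI v hv h a ha d, glueCopy, show G v a d 0 = v from (hc.isPath a ha d).1, if_neg h]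
      exact hc.copy_eq a ha d
  have hnext : ∀ v, I v → ∀ a < k v, ∀ d : Fin N,
      (I (dec v a d).1 ∨ L (dec v a d).1) ∧ (dec v a d).2 < k (dec v a d).1 := fun v h a ha d =>
    ⟨hch v h _ (hdig v h a ha d).1, (hdig v h a ha d).2.1⟩
  have hAc : ∀ v, (I v ∨ L v) → ∀ p q, IsPath ch {v} p → IsPath ch {v} q →
      (∀ i ≤ c + 1, p i = q i) → glueCopy I grp A p = glueCopy I grp A q := by
    intro v hv p q hp hq hpq
    have h0 : p 0 = v := hp.1
    by_cases h : I v
    · simp only [glueCopy, ← hpq 0 (by omega), ← hpq 1 (by omega), h0, h, if_true]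
    · simp only [glueCopy, ← hpq 0 (by omega), h0, h, if_false]
      exact (hL _ (hv.resolve_left h)).copy_congr p q hp hq fun i hi => hpq i (by omega)
  refine ⟨hA v hv, ?_, ?_, hAG v hv, ?_, hAc v hv, ?_, ?_⟩
  · intro p hp
    funext n
    induction n generalizing v p with
    | zero => exact hp.1.symm
    | succ n ih =>
      obtain rfl : p 0 = v := hp.1
      by_cases h : I (p 0)
      · have h1 := hch _ h _ (hp.2 0)
        have h2 := hdec _ h _ (hp.2 0) _ (hA _ h1 _ hp.tail)
        simp only [gluePath, h, if_true, glueDigit]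
        rw [show glueCopy I grp A p = grp (p 0) (p 1) by simp [glueCopy, h], h2]
        exact ih _ h1 _ hp.tail
      · have hc := hL _ (hv.resolve_left h)
        have h1 := hnotI _ hv h _ (hA _ hv _ hp) (fun n => glueDigit I grp dig A D n p)
        rw [congrFun h1 (n + 1)]
        have h2 : (fun n => glueDigit I grp dig A D n p) = D (p 0) p := by
          funext n; cases n <;> simp [glueDigit, h]
        have h3 : glueCopy I grp A p = A (p 0) p := by simp [glueCopy, h]
        rw [h2, h3, hc.left_inv p hp]
  · intro a ha d
    refine ⟨rfl, fun n => ?_⟩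
    by_cases h : I v
    · induction n generalizing v a d with
      | zero => simpa [gluePath, h] using (hdig v h a ha (d 0)).1
      | succ n ih =>
        obtain ⟨h1, h2⟩ := hnext v h a ha (d 0)
        by_cases h3 : I (dec v a (d 0)).1
        · have := ih _ h1 _ h2 (fun i => d (i + 1)) h3
          simpa [gluePath, h] using this
        · have h4 := hnotI _ h1 h3 _ h2 (fun i => d (i + 1))
          have h5 := ((hL _ (h1.resolve_left h3)).isPath _ h2 fun i => d (i + 1)).2 n
          rw [← h4] at h5
          simpa only [gluePath, h, if_true] using h5
    · have h4 := hnotI _ hv h _ ha d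
      have h5 := ((hL _ (hv.resolve_left h)).isPath _ ha d).2 n
      rwa [← h4] at h5
  · intro a ha d
    funext n
    induction n generalizing v a d with
    | zero =>
      by_cases h : I v
      · obtain ⟨h1, h2⟩ := hnext v h a ha (d 0)
        have h3 := hAG _ h1 _ h2 (fun i => d (i + 1))
        simp only [glueDigit, gluePath, h, if_true]
        rw [h3]
        exact (hdig v h a ha (d 0)).2.2.2
      · have hc := hL _ (hv.resolve_left h)
        rw [hnotI _ hv h _ ha d]
        simp only [glueDigit, show G v a d 0 = v from (hc.isPath a ha d).1, h, if_false]
        exact congrFun (hc.digit_eq a ha d) 0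
    | succ n ih =>
      by_cases h : I v
      · obtain ⟨h1, h2⟩ := hnext v h a ha (d 0)
        have h3 := ih _ h1 _ h2 (fun i => d (i + 1))
        simpa [glueDigit, gluePath, h] using h3
      · have hc := hL _ (hv.resolve_left h)
        rw [hnotI _ hv h _ ha d]
        simp only [glueDigit, show G v a d 0 = v from (hc.isPath a ha d).1, h, if_false]
        exact congrFun (hc.digit_eq a ha d) (n + 1)
  · intro n p q hp hq hpq
    induction n generalizing v p q with
    | zero =>
      have h0 : p 0 = v := hp.1
      by_cases h : I v
      · have h1 := hch _ (h0 ▸ h) _ (hp.2 0)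
        have hq' := hq.tail
        rw [← hpq 1 (by omega)] at hq'
        have h2 := hAc _ h1 _ _ hp.tail hq' fun i hi => hpq (i + 1) (by omega)
        simp only [glueDigit, ← hpq 0 (by omega), ← hpq 1 (by omega), h0, h, if_true, h2]
      · simp only [glueDigit, ← hpq 0 (by omega), h0, h, if_false]
        exact (hL _ (hv.resolve_left h)).digit_congr 0 p q hp hq fun i hi => hpq i (by omega)
    | succ n ih =>
      have h0 : p 0 = v := hp.1
      by_cases h : I v
      · have h1 := hch _ (h0 ▸ h) _ (hp.2 0)
        have hq' := hq.tail
        rw [← hpq 1 (by omega)] at hq'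
        simp only [glueDigit, ← hpq 0 (by omega), h0, h, if_true]
        exact ih _ h1 _ _ hp.tail hq' fun i hi => hpq (i + 1) (by omega)
      · simp only [glueDigit, ← hpq 0 (by omega), h0, h, if_false]
        exact (hL _ (hv.resolve_left h)).digit_congr _ p q hp hq fun i hi => hpq i (by omega)
  · intro n a ha d e hde
    induction n generalizing v a d e with
    | zero => rfl
    | succ n ih =>
      by_cases h : I v
      · obtain ⟨h1, h2⟩ := hnext v h a ha (d 0)
        simp only [gluePath, h, if_true, ← hde 0 (by omega)]
        exact ih _ h1 _ h2 _ _ fun i hi => hde (i + 1) (by omega)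
      · have hc := hL _ (hv.resolve_left h)
        simp only [gluePath, h, if_false]
        exact hc.path_congr _ a ha d e fun i hi => hde i (by omega)

/-- If the vertices in `I` can be packed and their offspring outside of `I` are equivalent to spaces
of words, then the vertices in `I` are equivalent to spaces of words as well. -/
theorem ShiftEquiv.of_isPacking {c : ℕ} (hN : 0 < N)
    (hch : ∀ v, I v → ∀ u ∈ ch v, I u ∨ ShiftEquiv c (paths ch {u}) (words N (k u)))
    (hI : ∀ v, I v → IsPacking ch k N v) (v : V) (hv : I v) :
    ShiftEquiv (c + 1) (paths ch {v}) (words N (k v)) := by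
  classical
  have h1 : ∀ v, ∃ (grp : V → ℕ) (dig : V → ℕ → Fin N) (dec : ℕ → Fin N → V × ℕ), I v →
      (∀ u ∈ ch v, grp u < k v) ∧
      (∀ u ∈ ch v, ∀ b < k u, dec (grp u) (dig u b) = (u, b)) ∧
      ∀ a < k v, ∀ d, (dec a d).1 ∈ ch v ∧ (dec a d).2 < k (dec a d).1 ∧
        grp (dec a d).1 = a ∧ dig (dec a d).1 (dec a d).2 = d := by
    intro v
    by_cases h : I v
    · obtain ⟨grp, dig, dec, h⟩ := (hI v h).exists_enumeration hN
      exact ⟨grp, dig, dec, fun _ => h⟩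
    · exact ⟨fun _ => 0, fun _ _ => ⟨0, hN⟩, fun _ _ => (v, 0), fun h' => absurd h' h⟩
  choose grp dig dec h1 using h1
  have h2 : ∀ v, ∃ A D G, ShiftEquiv c (paths ch {v}) (words N (k v)) →
      IsCoding ch {v} N (k v) c A D G := by
    intro v
    by_cases h : ShiftEquiv c (paths ch {v}) (words N (k v))
    · obtain ⟨A, D, G, h⟩ := h.exists_isCoding hN (Set.singleton_nonempty v)
      exact ⟨A, D, G, fun _ => h⟩
    · exact ⟨fun _ => 0, fun _ _ => ⟨0, hN⟩, fun _ _ _ => v, fun h' => absurd h' h⟩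
  choose A D G h2 using h2
  refine (isCoding_glue (I := I) (A := A) (D := D) (G := G) (grp := grp) (dig := dig) (dec := dec)
    (L := fun v => ¬ I v ∧ ShiftEquiv c (paths ch {v}) (words N (k v))) ?_
    (fun v hv => (h1 v hv).1) (fun v hv => (h1 v hv).2.1) (fun v hv => (h1 v hv).2.2)
    (fun v hv => h2 v hv.2) v (Or.inl hv)).shiftEquiv
  intro v hv u hu
  by_cases h : I u
  · exact Or.inl h
  · exact Or.inr ⟨h, (hch v hv u hu).resolve_left h⟩

/-- The paths that start in a finite set of vertices each of which is equivalent to the space of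
words. -/
theorem ShiftEquiv.of_forall_mem {c : ℕ} (hN : 0 < N) (s : Finset V)
    (hs : ∀ v ∈ s, ShiftEquiv c (paths ch {v}) (words N 1)) :
    ShiftEquiv c (paths ch s) (words N s.card) := by
  classical
  rcases s.eq_empty_or_nonempty with rfl | ⟨v₀, -⟩
  · have h1 : IsEmpty (paths ch (∅ : Finset V)).carrier := ⟨fun p => by simpa using p.2.1⟩
    have h2 : IsEmpty (words N (∅ : Finset V).card).carrier := ⟨fun x => x.1.elim0⟩
    exact ⟨Equiv.equivOfIsEmpty _ _, fun n x => h1.elim x⟩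
  have h2 : ∀ v, ∃ A D G, v ∈ s → IsCoding ch {v} N 1 c A D G := by
    intro v
    by_cases h : v ∈ s
    · obtain ⟨A, D, G, h⟩ := (hs v h).exists_isCoding hN (Set.singleton_nonempty v)
      exact ⟨A, D, G, fun _ => h⟩
    · exact ⟨fun _ => 0, fun _ _ => ⟨0, hN⟩, fun _ _ _ => v, fun h' => absurd h' h⟩
  choose A D G h2 using h2
  let e := s.equivFin
  let idx : V → ℕ := fun v => if h : v ∈ s then e ⟨v, h⟩ else 0
  let vtx : ℕ → V := fun a => if h : a < s.card then e.symm ⟨a, h⟩ else v₀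
  have hidx : ∀ v ∈ s, idx v < s.card := fun v hv => by simp [idx, hv]
  have hvtx : ∀ a < s.card, vtx a ∈ s := fun a ha => by simp [vtx, ha]
  have hvi : ∀ v ∈ s, vtx (idx v) = v := fun v hv => by simp [idx, vtx, hv]
  have hiv : ∀ a < s.card, idx (vtx a) = a := fun a ha => by
    have := hvtx a ha
    simp only [vtx, ha, dite_true] at this
    simp [idx, vtx, ha]
  have hA : ∀ p, IsPath ch s p → A (p 0) p = 0 := fun p hp => by
    have := (h2 _ hp.1).lt p ⟨rfl, hp.2⟩
    omega
  have hG : ∀ a < s.card, ∀ d, IsPath ch {vtx a} (G (vtx a) 0 d) := fun a ha d =>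
    (h2 _ (hvtx a ha)).isPath 0 one_pos d
  have hG0 : ∀ a < s.card, ∀ d, G (vtx a) 0 d 0 = vtx a := fun a ha d => (hG a ha d).1
  -- Each start vertex needs only copy 0, so the copy number is free to record the start vertex.
  refine (show IsCoding ch s N s.card c (fun p => idx (p 0)) (fun p => D (p 0) p)
    (fun a d => G (vtx a) 0 d) from ⟨?_, ?_, ?_, ?_, ?_, ?_, ?_, ?_⟩).shiftEquiv
  · exact fun p hp => hidx _ hp.1
  · intro p hp
    have := (h2 _ hp.1).left_inv p ⟨rfl, hp.2⟩
    rw [hA p hp] at this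
    simp only [hvi _ hp.1, this]
  · intro a ha d
    refine ⟨?_, (hG a ha d).2⟩
    rw [hG0 a ha]
    exact hvtx a ha
  · intro a ha d
    simp only [hG0 a ha, hiv a ha]
  · intro a ha d
    simp only [hG0 a ha]
    exact (h2 _ (hvtx a ha)).digit_eq 0 one_pos d
  · intro p q _ _ hpq
    simp only [hpq 0 (by omega)]
  · intro n p q hp hq hpq
    have h0 := hpq 0 (by omega)
    simp only [← h0]
    exact (h2 _ hp.1).digit_congr n p q ⟨rfl, hp.2⟩ ⟨h0.symm, hq.2⟩ hpq
  · intro n a ha d e hde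
    exact (h2 _ (hvtx a ha)).path_congr n 0 one_pos d e hde

end Packing

end FilteredSet

/-! ### Dividing finite weighted sets into groups with equal sums -/

section SubsetSums

variable {ι V : Type}

/-- All large numbers are combinations of the quotients `f s / g`, where `g` is the greatest common
divisor of the `f s`. -/
theorem exists_forall_ge_sum_eq (W : Finset ι) (f : ι → ℕ) (hg : 0 < W.gcd f) :
    ∃ R, ∀ m ≥ R, ∃ c : ι → ℕ, ∑ s ∈ W, c s * (f s / W.gcd f) = m := by
  classical
  obtain ⟨R, hR⟩ := Nat.exists_mem_closure_of_ge (Set.range fun s : W => f s)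
  refine ⟨R, fun m hm => ?_⟩
  have hd : Nat.setGcd (Set.range fun s : W => f s) ∣ W.gcd f :=
    Finset.dvd_gcd fun s hs => Nat.setGcd_dvd_of_mem ⟨⟨s, hs⟩, rfl⟩
  -- The Frobenius bound is applied to `m * W.gcd f`, which is at least `m`; the factor is cancelled
  -- at the end.
  have h1 := hR (m * W.gcd f) (hm.trans (Nat.le_mul_of_pos_right _ hg)) (hd.mul_left m)
  rw [AddSubmonoid.mem_closure_range_iff_of_fintype] at h1
  obtain ⟨a, ha⟩ := h1
  refine ⟨fun s => if h : s ∈ W then a ⟨s, h⟩ else 0, ?_⟩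
  rw [← Finset.sum_coe_sort]
  apply Nat.eq_of_mul_eq_mul_right hg
  rw [ha, Finset.sum_mul]
  refine Finset.sum_congr rfl fun s _ => ?_
  simp only [s.2, dite_true, smul_eq_mul, mul_assoc]
  rw [Nat.div_mul_cancel (Finset.gcd_dvd s.2)]

/-- Adding elements one at a time raises the sum by at most `M`, so the partial sums cannot jump
over the window of length `M` below `X`. -/
theorem exists_subset_sum_le (C : Finset V) (f : V → ℕ) {M X : ℕ} (hf : ∀ u ∈ C, f u ≤ M)
    (hX : X ≤ ∑ u ∈ C, f u) : ∃ S ⊆ C, ∑ u ∈ S, f u ≤ X ∧ X ≤ ∑ u ∈ S, f u + M := by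
  classical
  induction C using Finset.induction_on with
  | empty =>
    simp only [Finset.sum_empty, Nat.le_zero] at hX
    exact ⟨∅, subset_rfl, by simp [hX]⟩
  | insert a C ha ih =>
    by_cases h : X ≤ ∑ u ∈ C, f u
    · obtain ⟨S, hS, h'⟩ := ih (fun u hu => hf u (Finset.mem_insert_of_mem hu)) h
      exact ⟨S, hS.trans (Finset.subset_insert _ _), h'⟩
    · rw [Finset.sum_insert ha] at hX
      have := hf a (Finset.mem_insert_self _ _)
      exact ⟨C, Finset.subset_insert _ _, by omega, by omega⟩

/-- Given many elements of each type in `W`, a subset with a prescribed sum can be found. -/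
theorem exists_subset_sum_eq [DecidableEq V] (C : Finset V) (τ : V → ι) (f : ι → ℕ)
    (W : Finset ι) {M R N j : ℕ}
    (hf : ∀ u ∈ C, f (τ u) ≤ M) (hW : ∀ s ∈ W, 0 < f s)
    (hR : ∀ m ≥ R, ∃ c : ι → ℕ, ∑ s ∈ W, c s * f s = m)
    (hj : ∀ s ∈ W, ∃ T ⊆ C, (∀ u ∈ T, τ u = s) ∧ T.card = j + (R + M))
    (hsum : N + W.card * ((j + (R + M)) * M) ≤ ∑ u ∈ C, f (τ u)) (hRN : R ≤ N) :
    ∃ S ⊆ C, ∑ u ∈ S, f (τ u) = N ∧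
      ∀ s ∈ W, ∃ T ⊆ C \ S, (∀ u ∈ T, τ u = s) ∧ T.card = j := by
  classical
  have hj' : ∀ s, ∃ T : Finset V, s ∈ W → T ⊆ C ∧ (∀ u ∈ T, τ u = s) ∧ T.card = j + (R + M) := by
    intro s
    by_cases h : s ∈ W
    · obtain ⟨T, hT⟩ := hj s h
      exact ⟨T, fun _ => hT⟩
    · exact ⟨∅, fun h' => absurd h' h⟩
  choose T hT using hj'
  -- The reserve: `j + (R + M)` elements of each type in `W`. The greedy choice avoids it, so it is
  -- available for the exact correction.
  let D := W.biUnion T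
  have hDC : D ⊆ C := Finset.biUnion_subset.2 fun s hs => (hT s hs).1
  have hDsum : ∑ u ∈ D, f (τ u) ≤ W.card * ((j + (R + M)) * M) := by
    calc ∑ u ∈ D, f (τ u) ≤ D.card * M :=
          (Finset.sum_le_card_nsmul _ _ M fun u hu => hf u (hDC hu)).trans_eq (smul_eq_mul _ _)
      _ ≤ (W.card * (j + (R + M))) * M := by
          gcongr
          exact Finset.card_biUnion_le_card_mul _ _ _ fun s hs => (hT s hs).2.2.le
      _ = _ := by ring
  have hdiff := Finset.sum_sdiff (f := fun u => f (τ u)) hDC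
  obtain ⟨S₀, hS₀, h1, h2⟩ := exists_subset_sum_le (C \ D) (fun u => f (τ u)) (M := M) (X := N - R)
    (fun u hu => hf u (Finset.mem_sdiff.1 hu).1) (by omega)
  -- The deficit lies between `R` and `R + M`. It is therefore representable, and no coefficient
  -- exceeds `R + M`, which leaves `j` reserved elements of each type.
  obtain ⟨c, hc⟩ := hR (N - ∑ u ∈ S₀, f (τ u)) (by omega)
  have hcle : ∀ s ∈ W, c s ≤ R + M := by
    intro s hs
    have h3 : c s * f s ≤ ∑ s ∈ W, c s * f s :=
      Finset.single_le_sum (f := fun s => c s * f s) (fun _ _ => Nat.zero_le _) hs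
    have h4 := Nat.le_mul_of_pos_right (c s) (hW s hs)
    omega
  have hex : ∀ s, ∃ U : Finset V, s ∈ W → U ⊆ T s ∧ U.card = c s := by
    intro s
    by_cases h : s ∈ W
    · obtain ⟨U, hU⟩ := Finset.exists_subset_card_eq (s := T s) (n := c s)
        (by rw [(hT s h).2.2]; have := hcle s h; omega)
      exact ⟨U, fun _ => hU⟩
    · exact ⟨∅, fun h' => absurd h' h⟩
  choose U hU using hex
  have hUD : W.biUnion U ⊆ D := Finset.biUnion_mono fun s hs => (hU s hs).1
  have hdisj : Disjoint S₀ (W.biUnion U) :=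
    (Finset.disjoint_of_subset_left hS₀ Finset.sdiff_disjoint).mono_right hUD
  refine ⟨S₀ ∪ W.biUnion U, Finset.union_subset (hS₀.trans Finset.sdiff_subset) (hUD.trans hDC),
    ?_, fun s hs => ?_⟩
  · rw [Finset.sum_union hdisj, Finset.sum_biUnion]
    · have : ∑ s ∈ W, ∑ u ∈ U s, f (τ u) = ∑ s ∈ W, c s * f s := by
        refine Finset.sum_congr rfl fun s hs => ?_
        rw [Finset.sum_congr rfl fun u hu => by rw [(hT s hs).2.1 u ((hU s hs).1 hu)],
          Finset.sum_const, (hU s hs).2, smul_eq_mul]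
      omega
    · intro s hs t ht hst
      rw [Function.onFun, Finset.disjoint_left]
      intro u hu hu'
      exact hst (((hT s hs).2.1 u ((hU s hs).1 hu)).symm.trans ((hT t ht).2.1 u ((hU t ht).1 hu')))
  · obtain ⟨T', hT', hcard⟩ := Finset.exists_subset_card_eq (s := T s \ U s) (n := j) (by
      rw [Finset.card_sdiff_of_subset (hU s hs).1, (hT s hs).2.2, (hU s hs).2]
      have := hcle s hs
      omega)
    refine ⟨T', fun u hu => ?_, fun u hu => (hT s hs).2.1 u (Finset.mem_sdiff.1 (hT' hu)).1, hcard⟩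
    have hu1 := Finset.mem_sdiff.1 (hT' hu)
    have huD : u ∈ D := Finset.mem_biUnion.2 ⟨s, hs, hu1.1⟩
    rw [Finset.mem_sdiff, Finset.mem_union, not_or]
    refine ⟨hDC huD, fun h => (Finset.mem_sdiff.1 (hS₀ h)).2 huD, fun h => ?_⟩
    obtain ⟨t, ht, hut⟩ := Finset.mem_biUnion.1 h
    obtain rfl : s = t :=
      ((hT s hs).2.1 u hu1.1).symm.trans ((hT t ht).2.1 u ((hU t ht).1 hut))
    exact hu1.2 hut

/-- Given many elements of each type in `W`, a finite set can be divided into groups with equal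
sums. -/
theorem exists_groups_sum_eq (τ : V → ι) (f : ι → ℕ) (W : Finset ι) {M R N : ℕ}
    (hW : ∀ s ∈ W, 0 < f s)
    (hR : ∀ m ≥ R, ∃ c : ι → ℕ, ∑ s ∈ W, c s * f s = m) (hRN : R ≤ N) (K : ℕ) (C : Finset V)
    (hf0 : ∀ u ∈ C, 0 < f (τ u)) (hf : ∀ u ∈ C, f (τ u) ≤ M)
    (hj : ∀ s ∈ W, ∃ T ⊆ C, (∀ u ∈ T, τ u = s) ∧ T.card = K * (R + M))
    (hN : W.card * (K * (R + M) * M) ≤ N)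
    (hsum : ∑ u ∈ C, f (τ u) = N * K) :
    ∃ grp : V → ℕ, (∀ u ∈ C, grp u < K) ∧ ∀ i < K, ∑ u ∈ C with grp u = i, f (τ u) = N := by
  classical
  induction K generalizing C with
  | zero =>
    refine ⟨fun _ => 0, fun u hu => ?_, fun i hi => absurd hi (by omega)⟩
    have := Finset.sum_eq_zero_iff.1 (hsum.trans (mul_zero N)) u hu
    have := hf0 u hu
    omega
  | succ K ih =>
    -- The last group is whatever is left. Otherwise the total exceeds `N` by `N * K ≥ N`, which by
    -- `hN` pays for the reserve.
    rcases Nat.eq_zero_or_pos K with rfl | hK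
    · refine ⟨fun _ => 0, fun _ _ => Nat.one_pos, fun i hi => ?_⟩
      obtain rfl : i = 0 := by omega
      rw [Finset.filter_true_of_mem fun _ _ => rfl, hsum]
      ring
    have hK1 : (K + 1) * (R + M) = K * (R + M) + (R + M) := by ring
    rw [hK1] at hj hN
    obtain ⟨S, hS, hSN, hrest⟩ := exists_subset_sum_eq C τ f W (j := K * (R + M)) (N := N) hf hW hR
      hj (by rw [hsum]; nlinarith) hRN
    have hsd := Finset.sum_sdiff (f := fun u => f (τ u)) hS
    obtain ⟨grp, hg, hgs⟩ := ih (C \ S) (fun u hu => hf0 u (Finset.mem_sdiff.1 hu).1)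
      (fun u hu => hf u (Finset.mem_sdiff.1 hu).1) hrest
      (le_trans (by gcongr; omega) hN) (by rw [hSN, hsum] at hsd; linarith)
    refine ⟨fun u => if u ∈ S then K else grp u, fun u hu => ?_, fun i hi => ?_⟩
    · dsimp only
      split_ifs with h
      · omega
      · exact (hg u (Finset.mem_sdiff.2 ⟨hu, h⟩)).trans (by omega)
    · rcases Nat.lt_succ_iff_lt_or_eq.1 hi with h | rfl
      · rw [← hgs i h]
        refine Finset.sum_congr (Finset.ext fun u => ?_) fun _ _ => rfl
        simp only [Finset.mem_filter, Finset.mem_sdiff]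
        by_cases hu : u ∈ S
        · simp [hu, h.ne']
        · simp [hu]
      · rw [← hSN]
        refine Finset.sum_congr (Finset.ext fun u => ?_) fun _ _ => rfl
        simp only [Finset.mem_filter]
        by_cases hu : u ∈ S
        · simp [hu, hS hu]
        · simp only [hu, if_false, iff_false, not_and]
          intro h1 h2
          exact absurd (hg u (Finset.mem_sdiff.2 ⟨h1, hu⟩)) (by omega)

/-- A finite set of free elements and few fixed ones can be divided into groups of equal size, if
the free elements may be counted with arbitrary multiplicities. -/
theorem exists_groups_of_free [DecidableEq V] (T B : Finset V) (hTB : Disjoint T B)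
    {K N : ℕ} (hK : 0 < K)
    (hKT : K ≤ T.card) (hT : T.card / K + 1 + K * B.card ≤ N) :
    ∃ grp k : V → ℕ, (∀ u, grp u < K) ∧ (∀ u ∈ T, 0 < k u ∧ k u ≤ N) ∧ (∀ u ∈ B, k u = K) ∧
      ∀ i < K, ∑ u ∈ T ∪ B with grp u = i, k u = N := by
  classical
  let e := T.equivFin
  -- The free elements are dealt out in turn to the `K` groups, and all fixed elements go to group
  -- 0.
  let g : V → ℕ := fun u => if h : u ∈ T then (e ⟨u, h⟩ : ℕ) % K else 0
  let P : ℕ → Finset V := fun i => T.filter fun u => g u = i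
  have hne : ∀ i < K, (P i).Nonempty := by
    intro i hi
    refine ⟨e.symm ⟨i, hi.trans_le hKT⟩, Finset.mem_filter.2 ⟨Subtype.mem _, ?_⟩⟩
    simp [g, Nat.mod_eq_of_lt hi]
  have hcard : ∀ i, (P i).card ≤ T.card / K + 1 := by
    intro i
    rw [← Finset.card_range (T.card / K + 1)]
    refine Finset.card_le_card_of_injOn (fun u => if h : u ∈ T then (e ⟨u, h⟩ : ℕ) / K else 0) ?_ ?_
    · intro u hu
      have huT := (Finset.mem_filter.1 hu).1
      simp only [huT, dite_true, Finset.coe_range, Set.mem_Iio, Nat.lt_succ_iff]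
      exact Nat.div_le_div_right (e ⟨u, huT⟩).2.le
    · intro u hu v hv huv
      obtain ⟨huT, hu2⟩ := Finset.mem_filter.1 hu
      obtain ⟨hvT, hv2⟩ := Finset.mem_filter.1 hv
      simp only [huT, hvT, dite_true, g] at huv hu2 hv2
      have : (e ⟨u, huT⟩ : ℕ) = e ⟨v, hvT⟩ := by
        rw [← Nat.div_add_mod (e ⟨u, huT⟩ : ℕ) K, huv, hu2, ← hv2, Nat.div_add_mod]
      exact congrArg Subtype.val (e.injective (Fin.ext this))
  have : Nonempty V := ⟨(hne 0 hK).choose⟩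
  choose! x hx using hne
  -- `Y i` is what the free elements of group `i` must contribute. Each counts once, except for the
  -- chosen element `x i`, which absorbs the remainder.
  let Y : ℕ → ℕ := fun i => if i = 0 then N - K * B.card else N
  have hY : ∀ i, (P i).card ≤ Y i := fun i => by
    have := hcard i
    simp only [Y]; split_ifs <;> omega
  have hYN : ∀ i, Y i ≤ N := fun i => by simp only [Y]; split_ifs <;> omega
  have hg : ∀ u, g u < K := fun u => by
    simp only [g]; split_ifs
    exacts [Nat.mod_lt _ hK, hK]
  let k : V → ℕ := fun u => if u ∈ B then K else
    if u = x (g u) then Y (g u) - (P (g u)).card + 1 else 1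
  have hkT : ∀ i < K, ∑ u ∈ P i, k u = Y i := by
    intro i hi
    have h1 : ∀ u ∈ P i, k u = (if u = x i then Y i - (P i).card else 0) + 1 := by
      intro u hu
      obtain ⟨huT, rfl⟩ := Finset.mem_filter.1 hu
      have huB := Finset.disjoint_left.1 hTB huT
      simp only [k, huB, if_false]
      split_ifs <;> rfl
    rw [Finset.sum_congr rfl h1, Finset.sum_add_distrib, Finset.sum_ite_eq' (P i) (x i),
      if_pos (hx i hi)]
    have := hY i
    simp only [Finset.sum_const, smul_eq_mul, mul_one]
    omega
  refine ⟨g, k, hg, fun u hu => ?_, fun u hu => by simp [k, hu], fun i hi => ?_⟩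
  · have huB := Finset.disjoint_left.1 hTB hu
    have h1 : 0 < (P (g u)).card := Finset.card_pos.2 ⟨u, Finset.mem_filter.2 ⟨hu, rfl⟩⟩
    have h2 := hY (g u)
    have h3 := hYN (g u)
    simp only [k, huB, if_false]
    split_ifs <;> omega
  · rw [Finset.filter_union, Finset.sum_union (Finset.disjoint_filter_filter hTB)]
    rw [hkT i hi]
    have hgB : ∀ u ∈ B, g u = 0 := fun u hu => by
      simp [g, Finset.disjoint_right.1 hTB hu]
    by_cases h0 : i = 0
    · rw [Finset.filter_true_of_mem fun u hu => (hgB u hu).trans h0.symm,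
        Finset.sum_congr rfl (g := fun _ => K) fun u hu => by simp [k, hu]]
      simp only [Y, h0, if_true, Finset.sum_const, smul_eq_mul]
      rw [mul_comm B.card]
      exact Nat.sub_add_cancel ((Nat.le_add_left _ _).trans hT)
    · rw [Finset.filter_false_of_mem fun u hu h => h0 (h.symm.trans (hgB u hu))]
      simp [Y, h0]

end SubsetSums

/-! ### Typed forests: generations, reachability of types, terminal types -/

/-- A forest in which the vertices have finitely many offspring, a type and a positive weight that
depends on the type, such that the weight of the offspring of a vertex is `N` times its own weight
and vertices of equal type have offspring of the same types. -/
structure TypedForest (V ι : Type) where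
  ch : V → Finset V
  eq_of_mem : ∀ v v' u, u ∈ ch v → u ∈ ch v' → v = v'
  type : V → ι
  wt : ι → ℕ
  wt_pos : ∀ v, 0 < wt (type v)
  N : ℕ
  sum_wt : ∀ v, ∑ u ∈ ch v, wt (type u) = N * wt (type v)
  exists_type_eq : ∀ v v', type v = type v' → ∀ u ∈ ch v, ∃ u' ∈ ch v', type u' = type u

namespace TypedForest

open FilteredSet

variable {V ι : Type} (X : TypedForest V ι)

open Classical in
/-- The descendants of `v` in the `n`-th generation. -/
noncomputable def iter : ℕ → V → Finset V
  | 0, v => {v}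
  | n + 1, v => (iter n v).biUnion X.ch

theorem mem_iter_succ {n : ℕ} {u v : V} : u ∈ X.iter (n + 1) v ↔ ∃ x ∈ X.iter n v, u ∈ X.ch x := by
  simp [iter]

theorem mem_iter_add {a b : ℕ} {u v : V} :
    u ∈ X.iter (a + b) v ↔ ∃ x ∈ X.iter a v, u ∈ X.iter b x := by
  induction b generalizing u with
  | zero => simp [iter]
  | succ b ih =>
    rw [← add_assoc, mem_iter_succ]
    simp only [ih, mem_iter_succ]
    constructor
    · rintro ⟨x, ⟨y, hy, hx⟩, hu⟩
      exact ⟨y, hy, x, hx, hu⟩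
    · rintro ⟨y, hy, x, hx, hu⟩
      exact ⟨x, ⟨y, hy, hx⟩, hu⟩

theorem eq_of_mem_iter {n : ℕ} {v v' u : V} (h : u ∈ X.iter n v) (h' : u ∈ X.iter n v') :
    v = v' := by
  induction n generalizing u with
  | zero => simp only [iter, Finset.mem_singleton] at h h'; exact h.symm.trans h'
  | succ n ih =>
    obtain ⟨x, hx, hu⟩ := X.mem_iter_succ.1 h
    obtain ⟨x', hx', hu'⟩ := X.mem_iter_succ.1 h'
    obtain rfl := X.eq_of_mem _ _ _ hu hu'
    exact ih hx hx'

theorem sum_iter_succ (n : ℕ) (v : V) (f : V → ℕ) :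
    ∑ u ∈ X.iter (n + 1) v, f u = ∑ x ∈ X.iter n v, ∑ u ∈ X.ch x, f u := by
  classical
  rw [iter]
  convert Finset.sum_biUnion ?_
  intro x _ y _ hxy
  rw [Function.onFun, Finset.disjoint_left]
  exact fun u hu hu' => hxy (X.eq_of_mem _ _ _ hu hu')

theorem sum_wt_iter (n : ℕ) (v : V) :
    ∑ u ∈ X.iter n v, X.wt (X.type u) = X.N ^ n * X.wt (X.type v) := by
  induction n with
  | zero => simp [iter]
  | succ n ih =>
    rw [sum_iter_succ, Finset.sum_congr rfl fun x _ => X.sum_wt x, ← Finset.mul_sum, ih]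
    ring

theorem exists_type_eq_iter {n : ℕ} {v v' u : V} (h : X.type v = X.type v') (hu : u ∈ X.iter n v) :
    ∃ u' ∈ X.iter n v', X.type u' = X.type u := by
  induction n generalizing u with
  | zero =>
    simp only [iter, Finset.mem_singleton] at hu
    subst hu
    exact ⟨v', by simp [iter], h.symm⟩
  | succ n ih =>
    obtain ⟨x, hx, hu⟩ := X.mem_iter_succ.1 hu
    obtain ⟨x', hx', hxx⟩ := ih hx
    obtain ⟨u', hu', huu⟩ := X.exists_type_eq x x' hxx.symm u hu
    exact ⟨u', X.mem_iter_succ.2 ⟨x', hx', hu'⟩, huu⟩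

/-- The forest in which the offspring of `v` are the descendants of `v` in the `n`-th generation. -/
noncomputable def pow (n : ℕ) : TypedForest V ι where
  ch := X.iter n
  eq_of_mem _ _ _ h h' := X.eq_of_mem_iter h h'
  type := X.type
  wt := X.wt
  wt_pos := X.wt_pos
  N := X.N ^ n
  sum_wt := X.sum_wt_iter n
  exists_type_eq _ _ h _ hu := X.exists_type_eq_iter h hu

theorem iter_pow (p k : ℕ) : (X.pow p).iter k = X.iter (p * k) := by
  funext v
  ext u
  induction k generalizing u with
  | zero => simp [iter]
  | succ k ih =>
    rw [mem_iter_succ, mul_add, mul_one, mem_iter_add]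
    simp only [ih]
    rfl

/-- The type `s` occurs among the offspring of the vertices of type `t`. -/
def Rel (t s : ι) : Prop := ∃ v, ∃ u ∈ X.ch v, X.type v = t ∧ X.type u = s

theorem Rel.exists_mem {X : TypedForest V ι} {v : V} {s : ι} (h : X.Rel (X.type v) s) :
    ∃ u ∈ X.ch v, X.type u = s := by
  obtain ⟨v', u, hu, hv, rfl⟩ := h
  exact X.exists_type_eq v' v hv u hu

theorem rel_pow_add (a b : ℕ) (t s : ι) :
    (X.pow (a + b)).Rel t s ↔ ∃ x, (X.pow a).Rel t x ∧ (X.pow b).Rel x s := by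
  constructor
  · rintro ⟨v, u, hu, rfl, rfl⟩
    obtain ⟨x, hx, hux⟩ := X.mem_iter_add.1 hu
    exact ⟨X.type x, ⟨v, x, hx, rfl, rfl⟩, ⟨x, u, hux, rfl, rfl⟩⟩
  · rintro ⟨_, ⟨v, x, hx, rfl, rfl⟩, h⟩
    obtain ⟨u, hu, rfl⟩ := Rel.exists_mem (X := X.pow b) (v := x) h
    exact ⟨v, u, X.mem_iter_add.2 ⟨x, hx, hu⟩, rfl, rfl⟩

/-- The relations of successive generations are composition powers of one relation on a finite set,
hence eventually periodic. -/
theorem exists_rel_pow_eq [Finite ι] : ∃ p > 0, ∀ k > 0, (X.pow (p * k)).Rel = (X.pow p).Rel := by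
  obtain ⟨a, b, hab, h⟩ := Finite.exists_ne_map_eq_of_infinite fun n => (X.pow n).Rel
  wlog hlt : a < b generalizing a b
  · exact this b a hab.symm h.symm (by omega)
  obtain ⟨d, rfl⟩ := Nat.exists_eq_add_of_lt hlt
  have h1 : ∀ m, (X.pow (a + m + (d + 1))).Rel = (X.pow (a + m)).Rel := by
    intro m
    funext t s
    rw [show a + m + (d + 1) = a + d + 1 + m by ring]
    simp only [eq_iff_iff, rel_pow_add X _ m]
    rw [show (X.pow a).Rel = (X.pow (a + d + 1)).Rel from h]
  have h2 : ∀ j m, (X.pow (a + m + (d + 1) * j)).Rel = (X.pow (a + m)).Rel := by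
    intro j
    induction j with
    | zero => simp
    | succ j ih =>
      intro m
      rw [← ih m, add_assoc a m ((d + 1) * j), ← h1 (m + (d + 1) * j)]
      congr 2
      ring
  -- A multiple of the period `d + 1` that lies beyond the preperiod `a`.
  refine ⟨(d + 1) * (a + 1), by positivity, fun k hk => ?_⟩
  obtain ⟨k, rfl⟩ := Nat.exists_eq_add_of_lt hk
  obtain ⟨m, hm⟩ := Nat.exists_eq_add_of_le (show a ≤ (d + 1) * (a + 1) by nlinarith)
  have := h2 ((a + 1) * k) m
  rw [← hm] at this
  rw [← this]
  congr 2
  ring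

/-- The types from which every type that can be reached leads back. -/
def IsTerminal (t : ι) : Prop := ∀ s, X.Rel t s → X.Rel s t

/-- The relation between types is the same for all generations. -/
def IsStable : Prop := ∀ k > 0, (X.pow k).Rel = X.Rel

variable {X}

theorem IsStable.trans (hX : X.IsStable) {t s x : ι} (h : X.Rel t s) (h' : X.Rel s x) :
    X.Rel t x := by
  rw [← hX 2 two_pos, show 2 = 1 + 1 from rfl, rel_pow_add]
  rw [← hX 1 one_pos] at h h'
  exact ⟨s, h, h'⟩

theorem IsStable.rel (hX : X.IsStable) {k : ℕ} (hk : 0 < k) {u v : V} (h : u ∈ X.iter k v) :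
    X.Rel (X.type v) (X.type u) := by
  rw [← hX k hk]
  exact ⟨v, u, h, rfl, rfl⟩

theorem IsStable.isTerminal (hX : X.IsStable) {t s : ι} (ht : X.IsTerminal t) (h : X.Rel t s) :
    X.IsTerminal s := fun _ hx => hX.trans (ht _ (hX.trans h hx)) h

theorem IsStable.rel_iff (hX : X.IsStable) {t s : ι} (ht : X.IsTerminal t) (h : X.Rel t s) (x : ι) :
    X.Rel s x ↔ X.Rel t x := ⟨hX.trans h, hX.trans (ht _ h)⟩

theorem exists_mem_ch (hN : 0 < X.N) (v : V) : ∃ u, u ∈ X.ch v := by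
  by_contra! h
  have h1 := X.sum_wt v
  rw [Finset.eq_empty_of_forall_notMem h, Finset.sum_empty] at h1
  exact absurd h1.symm (Nat.mul_pos hN (X.wt_pos v)).ne'

/-- Take an offspring `u` with the fewest reachable types. By stability, every type reachable from
`u` already occurs among the offspring of `v`, so by minimality it reaches exactly the same types as
`u`. -/
theorem IsStable.exists_isTerminal [Finite ι] (hX : X.IsStable) (hN : 0 < X.N) (v : V) :
    ∃ u ∈ X.ch v, X.IsTerminal (X.type u) := by
  classical
  have := Fintype.ofFinite ι
  let f : V → ℕ := fun u => (Finset.univ.filter fun s => X.Rel (X.type u) s).card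
  obtain ⟨u, hu, hmin⟩ := Finset.exists_min_image (X.ch v) f (exists_mem_ch hN v)
  have key : ∀ x, X.Rel (X.type u) x → ∀ y, X.Rel x y ↔ X.Rel (X.type u) y := by
    intro x hx y
    obtain ⟨w, hw, rfl⟩ := (hX.trans ⟨v, u, hu, rfl, rfl⟩ hx).exists_mem
    have hsub : (Finset.univ.filter fun s => X.Rel (X.type w) s) ⊆
        Finset.univ.filter fun s => X.Rel (X.type u) s := by
      intro s hs
      simp only [Finset.mem_filter, Finset.mem_univ, true_and] at hs ⊢
      exact hX.trans hx hs
    have := Finset.ext_iff.1 (Finset.eq_of_subset_of_card_le hsub (hmin w hw)) y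
    simpa using this
  obtain ⟨u', hu'⟩ := exists_mem_ch hN u
  have h1 : X.Rel (X.type u) (X.type u') := ⟨u, u', hu', rfl, rfl⟩
  -- The type of `u` need not be reachable from itself. The type of an offspring of `u` is, and it
  -- also occurs among the offspring of `v`.
  obtain ⟨w, hw, hwu⟩ := (hX.trans ⟨v, u, hu, rfl, rfl⟩ h1).exists_mem
  refine ⟨w, hw, fun s hs => ?_⟩
  rw [hwu] at hs ⊢
  exact (key s ((key _ h1 s).1 hs) _).2 h1

variable {M : ℕ}

theorem pow_le_mul_card (hM : ∀ t, X.wt t ≤ M) (n : ℕ) (v : V) :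
    X.N ^ n * X.wt (X.type v) ≤ M * (X.iter n v).card := by
  rw [← sum_wt_iter, mul_comm M]
  exact (Finset.sum_le_card_nsmul _ _ M fun u _ => hM _).trans_eq (smul_eq_mul _ _)

/-- Generation `k` has at least `N ^ k / M` vertices. Each of them leads back to the type of `v` and
hence has an offspring of type `s`; vertices with different parents are different. -/
theorem IsStable.pow_le_mul_card_filter [DecidableEq ι] (hX : X.IsStable) (hM : ∀ t, X.wt t ≤ M)
    {v : V} (hv : X.IsTerminal (X.type v)) {s : ι} (hs : X.Rel (X.type v) s) (k : ℕ) :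
    X.N ^ k ≤ M * ((X.iter (k + 1) v).filter fun u => X.type u = s).card := by
  classical
  have h1 : ∀ x, ∃ u, x ∈ X.iter k v → u ∈ X.ch x ∧ X.type u = s := by
    intro x
    by_cases hx : x ∈ X.iter k v
    · have : X.Rel (X.type x) s := by
        rcases Nat.eq_zero_or_pos k with rfl | hk
        · obtain rfl : x = v := by simpa [iter] using hx
          exact hs
        · exact hX.trans (hv _ (hX.rel hk hx)) hs
      obtain ⟨u, hu⟩ := this.exists_mem
      exact ⟨u, fun _ => hu⟩
    · exact ⟨v, fun h => absurd h hx⟩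
  choose y hy using h1
  calc X.N ^ k ≤ X.N ^ k * X.wt (X.type v) := Nat.le_mul_of_pos_right _ (X.wt_pos v)
    _ ≤ M * (X.iter k v).card := pow_le_mul_card hM k v
    _ ≤ _ := by
      refine Nat.mul_le_mul_left _ ?_
      refine Finset.card_le_card_of_injOn y (fun x hx => ?_) fun x hx x' hx' h => ?_
      · exact Finset.mem_filter.2 ⟨X.mem_iter_succ.2 ⟨x, hx, (hy x hx).1⟩, (hy x hx).2⟩
      · have h1 := (hy x' hx').1
        rw [← h] at h1
        exact X.eq_of_mem _ _ _ (hy x hx).1 h1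

-- Terminal vertices have only terminal offspring, and every other vertex loses weight at least 1 to
-- a terminal offspring. As weights are at most `M`, each generation multiplies the non-terminal
-- weight by at most `1 - 1 / (M * N)`.
open Classical in
theorem IsStable.sum_not_isTerminal_le [Finite ι] (hX : X.IsStable) (hN : 0 < X.N)
    (hM : ∀ t, X.wt t ≤ M) (k : ℕ) (v : V) :
    M ^ k * ∑ u ∈ (X.iter k v).filter (fun u => ¬ X.IsTerminal (X.type u)), X.wt (X.type u) ≤
      (M * X.N - 1) ^ k * X.wt (X.type v) := by
  simp only [Finset.sum_filter]
  induction k with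
  | zero =>
    simp only [iter, Finset.sum_singleton, pow_zero, one_mul]
    split_ifs <;> simp
  | succ k ih =>
    have h1 : ∀ x, M * ∑ u ∈ X.ch x, (if ¬ X.IsTerminal (X.type u) then X.wt (X.type u) else 0) ≤
        (M * X.N - 1) * if ¬ X.IsTerminal (X.type x) then X.wt (X.type x) else 0 := by
      intro x
      by_cases hx : X.IsTerminal (X.type x)
      · rw [Finset.sum_eq_zero]
        · simp
        · intro u hu
          simp [hX.isTerminal hx ⟨x, u, hu, rfl, rfl⟩]
      · obtain ⟨w, hw, hwt⟩ := hX.exists_isTerminal hN x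
        have h2 : ∑ u ∈ X.ch x, (if ¬ X.IsTerminal (X.type u) then X.wt (X.type u) else 0) + 1 ≤
            X.N * X.wt (X.type x) := by
          rw [← X.sum_wt x, ← Finset.sum_erase_add _ _ hw, ← Finset.sum_erase_add (X.ch x) _ hw]
          simp only [hwt, not_true, if_false, add_zero]
          refine add_le_add (Finset.sum_le_sum fun u _ => ?_) (X.wt_pos w)
          split_ifs <;> simp
        simp only [hx, not_false_iff, if_true]
        rw [Nat.sub_mul, one_mul]
        apply Nat.le_sub_of_add_le
        calc _ ≤ _ := Nat.add_le_add_left (hM (X.type x)) _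
          _ = M * (_ + 1) := by rw [mul_add, mul_one]
          _ ≤ M * (X.N * X.wt (X.type x)) := Nat.mul_le_mul_left _ h2
          _ = _ := by ring
    rw [sum_iter_succ, pow_succ, mul_assoc, Finset.mul_sum]
    calc _ ≤ M ^ k * ∑ x ∈ X.iter k v,
          (M * X.N - 1) * if ¬ X.IsTerminal (X.type x) then X.wt (X.type x) else 0 := by
          exact Nat.mul_le_mul_left _ (Finset.sum_le_sum fun x _ => h1 x)
      _ = (M * X.N - 1) * (M ^ k * ∑ x ∈ X.iter k v,
          if ¬ X.IsTerminal (X.type x) then X.wt (X.type x) else 0) := by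
          rw [← Finset.mul_sum]; ring
      _ ≤ (M * X.N - 1) * ((M * X.N - 1) ^ k * X.wt (X.type v)) := by gcongr
      _ = _ := by ring

end TypedForest

/-! ### Coding the path spaces of a typed forest by words -/

theorem exists_forall_pred_pow_mul_le_pow (a Q : ℕ) (ha : 0 < a) :
    ∃ k₀, ∀ k ≥ k₀, (a - 1) ^ k * Q ≤ a ^ k := by
  have ha' : (0 : ℝ) < a := Nat.cast_pos.2 ha
  have h1 : Filter.Tendsto (fun k : ℕ => (((a - 1 : ℕ) : ℝ) / a) ^ k * Q) Filter.atTop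
      (nhds 0) := by
    have := (tendsto_pow_atTop_nhds_zero_of_lt_one (r := ((a - 1 : ℕ) : ℝ) / a) (by positivity)
      ((div_lt_one ha').2 (Nat.cast_lt.2 (by omega)))).mul_const (Q : ℝ)
    simpa using this
  obtain ⟨k₀, hk₀⟩ := Filter.eventually_atTop.1 (h1.eventually (gt_mem_nhds one_pos))
  refine ⟨k₀, fun k hk => ?_⟩
  have h2 := hk₀ k hk
  rw [div_pow, div_mul_eq_mul_div, div_lt_one (by positivity)] at h2
  exact_mod_cast h2.le

namespace TypedForest

open FilteredSet

variable {V ι : Type} {X : TypedForest V ι}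

open Classical in
/-- The types that can be reached from the type `t`. -/
noncomputable def reach [Fintype ι] (X : TypedForest V ι) (t : ι) : Finset ι :=
  Finset.univ.filter fun s => X.Rel t s

theorem mem_reach [Fintype ι] {t s : ι} : s ∈ X.reach t ↔ X.Rel t s := by simp [reach]

theorem Rel.wt_pos {t s : ι} (h : X.Rel t s) : 0 < X.wt s := by
  obtain ⟨_, u, _, _, rfl⟩ := h
  exact X.wt_pos u

theorem gcd_reach_pos [Fintype ι] (hN : 0 < X.N) (v : V) :
    0 < (X.reach (X.type v)).gcd X.wt := by
  obtain ⟨u, hu⟩ := exists_mem_ch hN v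
  have h : X.Rel (X.type v) (X.type u) := ⟨v, u, hu, rfl, rfl⟩
  refine Nat.pos_of_ne_zero fun h0 => ?_
  exact (X.wt_pos u).ne' (Finset.gcd_eq_zero_iff.1 h0 _ (mem_reach.2 h))

/-- The multiplicity is the weight divided by the gcd of the reachable weights. Descendants of a
terminal vertex reach the same types, so the gcd is constant along paths and the normalized weights
remain balanced. The bounds on `X.N ^ k` make every reachable type frequent enough for the exact
grouping. -/
theorem IsStable.isTerminal_shiftEquiv [Fintype ι] (hX : X.IsStable) (hN : 2 ≤ X.N) {M R : ℕ}
    (hM : ∀ t, X.wt t ≤ M)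
    (hR : ∀ t, 0 < (X.reach t).gcd X.wt → ∀ m ≥ R, ∃ c : ι → ℕ,
      ∑ s ∈ X.reach t, c s * (X.wt s / (X.reach t).gcd X.wt) = m)
    {k : ℕ} (hk : M * (M * (R + M)) ≤ X.N ^ k) (hk' : Fintype.card ι * (M * (R + M) * M) ≤ X.N ^ k)
    (hkR : R ≤ X.N ^ k) {v : V} (hv : X.IsTerminal (X.type v)) :
    ShiftEquiv 1 (paths (X.iter (k + 1)) {v})
      (words (X.N ^ (k + 1)) (X.wt (X.type v) / (X.reach (X.type v)).gcd X.wt)) := by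
  classical
  have hN0 : 0 < X.N := by omega
  have hle : X.N ^ k ≤ X.N ^ (k + 1) := Nat.pow_le_pow_right hN0 (Nat.le_succ k)
  refine ShiftEquiv.of_isPacking (c := 0) (I := fun v => X.IsTerminal (X.type v))
    (k := fun v => X.wt (X.type v) / (X.reach (X.type v)).gcd X.wt) (Nat.pow_pos hN0)
    (fun v hv u hu => Or.inl (hX.isTerminal hv (hX.rel (Nat.succ_pos k) hu))) ?_ v hv
  clear hv v
  intro v hv
  have hreach : ∀ u ∈ X.iter (k + 1) v, X.reach (X.type u) = X.reach (X.type v) := by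
    intro u hu
    ext s
    rw [mem_reach, mem_reach, hX.rel_iff hv (hX.rel (Nat.succ_pos k) hu)]
  set g := (X.reach (X.type v)).gcd X.wt with hg
  have hg0 : 0 < g := gcd_reach_pos hN0 v
  have hdvd : ∀ s, X.Rel (X.type v) s → g ∣ X.wt s := fun s hs => Finset.gcd_dvd (mem_reach.2 hs)
  have hvv : X.Rel (X.type v) (X.type v) := by
    obtain ⟨u, hu⟩ := exists_mem_ch hN0 v
    have h : X.Rel (X.type v) (X.type u) := ⟨v, u, hu, rfl, rfl⟩
    exact hX.trans h (hv _ h)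
  have hpos : ∀ s, X.Rel (X.type v) s → 0 < X.wt s / g := fun s hs =>
    Nat.div_pos (Nat.le_of_dvd hs.wt_pos (hdvd s hs)) hg0
  have hleM : ∀ s, X.wt s / g ≤ M := fun s => (Nat.div_le_self _ _).trans (hM s)
  have hM0 : 0 < M := (X.wt_pos v).trans_le (hM _)
  have hsum : ∑ u ∈ X.iter (k + 1) v, X.wt (X.type u) / g =
      X.N ^ (k + 1) * (X.wt (X.type v) / g) := by
    apply Nat.eq_of_mul_eq_mul_right hg0
    rw [Finset.sum_mul, mul_assoc, Nat.div_mul_cancel (hdvd _ hvv), ← X.sum_wt_iter]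
    exact Finset.sum_congr rfl fun u hu => Nat.div_mul_cancel (hdvd _ (hX.rel (Nat.succ_pos k) hu))
  have hj : ∀ s ∈ X.reach (X.type v), ∃ T ⊆ X.iter (k + 1) v, (∀ u ∈ T, X.type u = s) ∧
      T.card = X.wt (X.type v) / g * (R + M) := by
    intro s hs
    have h3 := hX.pow_le_mul_card_filter hM hv (mem_reach.1 hs) k
    have h4 := Nat.le_of_mul_le_mul_left (hk.trans h3) hM0
    obtain ⟨T, hT, hTc⟩ := Finset.exists_subset_card_eq
      (s := (X.iter (k + 1) v).filter fun u => X.type u = s)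
      (n := X.wt (X.type v) / g * (R + M)) (le_trans (by gcongr; exact hleM _) h4)
    exact ⟨T, fun u hu => (Finset.mem_filter.1 (hT hu)).1,
      fun u hu => (Finset.mem_filter.1 (hT hu)).2, hTc⟩
  have hbig : (X.reach (X.type v)).card * (X.wt (X.type v) / g * (R + M) * M) ≤
      X.N ^ (k + 1) := by
    refine le_trans ?_ (hk'.trans hle)
    gcongr
    · exact Finset.card_le_univ _
    · exact hleM _
  obtain ⟨grp, h1, h2⟩ := exists_groups_sum_eq X.type (fun s => X.wt s / g) (X.reach (X.type v))
    (M := M) (R := R) (N := X.N ^ (k + 1)) (fun s hs => hpos s (mem_reach.1 hs))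
    (hR _ hg0) (hkR.trans hle) (X.wt (X.type v) / g) (X.iter (k + 1) v)
    (fun u hu => hpos _ (hX.rel (Nat.succ_pos k) hu)) (fun u _ => hleM _) hj hbig hsum
  refine ⟨grp, h1, fun i hi => ?_⟩
  rw [← h2 i hi]
  refine Finset.sum_congr rfl fun u hu => ?_
  simp only [hreach u (Finset.mem_filter.1 hu).1, ← hg]

/-- With `2 * M` groups, the at most `X.N ^ k * M` terminal descendants take up about half of each
group when counted once. By `hfew`, the non-terminal ones, counted `2 * M` times each, need at most
a quarter of one group. Terminal multiplicities fill the rest. -/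
theorem IsStable.not_isTerminal_shiftEquiv [Finite ι] (hX : X.IsStable) (hN : 0 < X.N) {M k c : ℕ}
    (hM : ∀ t, X.wt t ≤ M) (hM0 : 0 < M)
    (hk : 4 * M ^ 2 ≤ X.N ^ k) (hk4 : 4 ≤ X.N ^ k)
    (hfew : (M * X.N - 1) ^ k * (8 * M ^ 2) ≤ (M * X.N) ^ k)
    (hterm : ∀ v, X.IsTerminal (X.type v) → ∀ j, 0 < j → j ≤ X.N ^ k →
      ShiftEquiv c (paths (X.iter k) {v}) (words (X.N ^ k) j))
    {v : V} (hv : ¬ X.IsTerminal (X.type v)) :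
    ShiftEquiv (c + 1) (paths (X.iter k) {v}) (words (X.N ^ k) (2 * M)) := by
  classical
  have hgroups : ∀ v, ∃ grp k' : V → ℕ, (∀ u, grp u < 2 * M) ∧
      (∀ u ∈ X.iter k v, X.IsTerminal (X.type u) → 0 < k' u ∧ k' u ≤ X.N ^ k) ∧
      (∀ u ∈ X.iter k v, ¬ X.IsTerminal (X.type u) → k' u = 2 * M) ∧
      ∀ i < 2 * M, ∑ u ∈ X.iter k v with grp u = i, k' u = X.N ^ k := by
    intro v
    set T := (X.iter k v).filter fun u => X.IsTerminal (X.type u) with hT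
    set B := (X.iter k v).filter fun u => ¬ X.IsTerminal (X.type u) with hB
    have hTB : T ∪ B = X.iter k v := Finset.filter_union_filter_not_eq _ _
    have hdisj : Disjoint T B := Finset.disjoint_filter_filter_not _ _ _
    have hcard : (X.iter k v).card = T.card + B.card := by
      rw [← hTB, Finset.card_union_of_disjoint hdisj]
    have h1 : X.N ^ k ≤ M * (X.iter k v).card :=
      (Nat.le_mul_of_pos_right _ (X.wt_pos v)).trans (pow_le_mul_card hM k v)
    have h2 : (X.iter k v).card ≤ X.N ^ k * M := by
      calc (X.iter k v).card = ∑ u ∈ X.iter k v, 1 := by simp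
        _ ≤ ∑ u ∈ X.iter k v, X.wt (X.type u) := Finset.sum_le_sum fun u _ => X.wt_pos u
        _ = X.N ^ k * X.wt (X.type v) := X.sum_wt_iter k v
        _ ≤ _ := by gcongr; exact hM _
    have h3 : 8 * M * B.card ≤ X.N ^ k := by
      have h4 : B.card ≤ ∑ u ∈ B, X.wt (X.type u) := by
        rw [Finset.card_eq_sum_ones]
        exact Finset.sum_le_sum fun u _ => X.wt_pos u
      have h5 := hX.sum_not_isTerminal_le hN hM k v
      have h6 : M ^ k * (8 * M * B.card) ≤ M ^ k * X.N ^ k := by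
        calc M ^ k * (8 * M * B.card) = (M ^ k * B.card) * (8 * M) := by ring
          _ ≤ ((M * X.N - 1) ^ k * M) * (8 * M) := by
            refine Nat.mul_le_mul_right _ ?_
            exact (Nat.mul_le_mul_left _ h4).trans (h5.trans (Nat.mul_le_mul_left _ (hM _)))
          _ = (M * X.N - 1) ^ k * (8 * M ^ 2) := by ring
          _ ≤ (M * X.N) ^ k := hfew
          _ = _ := mul_pow _ _ _
      exact Nat.le_of_mul_le_mul_left h6 (Nat.pow_pos hM0)
    have h7 : 2 * M ≤ T.card := by
      rw [hcard, mul_add] at h1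
      by_contra! h
      have h8 : M * T.card ≤ M * (2 * M - 1) := Nat.mul_le_mul_left _ (by omega)
      have h9 : M * (2 * M - 1) + M = 2 * M ^ 2 := by
        rw [← Nat.mul_succ, show (2 * M - 1).succ = 2 * M by omega]
        ring
      nlinarith
    have h8 : T.card / (2 * M) + 1 + 2 * M * B.card ≤ X.N ^ k := by
      have h9 : T.card / (2 * M) ≤ X.N ^ k / 2 := by
        rw [← Nat.mul_div_mul_right (X.N ^ k) 2 hM0]
        exact Nat.div_le_div_right (by omega)
      have h10 : 4 * (2 * M * B.card) ≤ X.N ^ k := le_trans (le_of_eq (by ring)) h3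
      omega
    obtain ⟨grp, k', g1, g2, g3, g4⟩ := exists_groups_of_free T B hdisj (by positivity) h7 h8
    rw [hTB] at g4
    exact ⟨grp, k', g1, fun u hu ht => g2 u (Finset.mem_filter.2 ⟨hu, ht⟩),
      fun u hu ht => g3 u (Finset.mem_filter.2 ⟨hu, ht⟩), g4⟩
  choose grp k' g1 g2 g3 g4 using hgroups
  -- The groupings are chosen parent by parent. Since the parent of a vertex in the forest of `k`-th
  -- generations is unique, the multiplicities combine into one function.
  let kk : V → ℕ := fun u => if X.IsTerminal (X.type u) then
    (if h : ∃ v, u ∈ X.iter k v then k' h.choose u else 1) else 2 * M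
  have hkk : ∀ v, ∀ u ∈ X.iter k v, kk u = k' v u := by
    intro v u hu
    by_cases ht : X.IsTerminal (X.type u)
    · have h : ∃ v, u ∈ X.iter k v := ⟨v, hu⟩
      simp only [kk, ht, if_true, dif_pos h]
      rw [X.eq_of_mem_iter h.choose_spec hu]
    · simp only [kk, ht, if_false]
      exact (g3 v u hu ht).symm
  have hkv : ∀ v, ¬ X.IsTerminal (X.type v) → kk v = 2 * M := fun v hv => by simp [kk, hv]
  rw [← hkv v hv]
  refine ShiftEquiv.of_isPacking (I := fun v => ¬ X.IsTerminal (X.type v)) (Nat.pow_pos hN)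
    (fun v hv u hu => ?_) (fun v hv => ?_) v hv
  · by_cases ht : X.IsTerminal (X.type u)
    · refine Or.inr (hterm u ht _ ?_ ?_)
      · rw [hkk v u hu]; exact (g2 v u hu ht).1
      · rw [hkk v u hu]; exact (g2 v u hu ht).2
    · exact Or.inl ht
  · rw [IsPacking, hkv v hv]
    refine ⟨grp v, fun u _ => g1 v u, fun i hi => ?_⟩
    rw [← g4 v i hi]
    exact Finset.sum_congr rfl fun u hu => hkk v u (Finset.mem_filter.1 hu).1

theorem IsStable.exists_shiftEquiv [Finite ι] (hX : X.IsStable) (hN : 2 ≤ X.N) :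
    ∃ k₀, ∀ k ≥ k₀, ∀ v, ShiftEquiv 8 (paths (X.iter k) {v}) (words (X.N ^ k) 1) := by
  classical
  have := Fintype.ofFinite ι
  have hN0 : 0 < X.N := by omega
  obtain ⟨M, hM⟩ : ∃ M, ∀ t, X.wt t ≤ M :=
    ⟨∑ t, X.wt t, fun t => Finset.single_le_sum (fun _ _ => Nat.zero_le _) (Finset.mem_univ t)⟩
  obtain ⟨R, hR⟩ : ∃ R, ∀ t, 0 < (X.reach t).gcd X.wt → ∀ m ≥ R, ∃ c : ι → ℕ,
      ∑ s ∈ X.reach t, c s * (X.wt s / (X.reach t).gcd X.wt) = m := by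
    have : ∀ t, ∃ R, 0 < (X.reach t).gcd X.wt → ∀ m ≥ R, ∃ c : ι → ℕ,
        ∑ s ∈ X.reach t, c s * (X.wt s / (X.reach t).gcd X.wt) = m := by
      intro t
      by_cases h : 0 < (X.reach t).gcd X.wt
      · obtain ⟨R, hR⟩ := exists_forall_ge_sum_eq (X.reach t) X.wt h
        exact ⟨R, fun _ => hR⟩
      · exact ⟨0, fun h' => absurd h' h⟩
    choose R hR using this
    exact ⟨∑ t, R t, fun t ht m hm => hR t ht m
      ((Finset.single_le_sum (fun _ _ => Nat.zero_le _) (Finset.mem_univ t)).trans hm)⟩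
  rcases Nat.eq_zero_or_pos M with rfl | hM0
  · exact ⟨0, fun k _ v => absurd (hM (X.type v)) (X.wt_pos v).not_ge⟩
  obtain ⟨k₁, hk₁⟩ := exists_forall_pred_pow_mul_le_pow (M * X.N) (8 * M ^ 2) (by positivity)
  -- `Q` dominates all size requirements on `X.N ^ k` at once, and `X.N ^ k > k ≥ Q`.
  set Q := M * (M * (R + M)) + Fintype.card ι * (M * (R + M) * M) + R + 4 * M ^ 2 + 4 with hQ
  refine ⟨k₁ + Q + 1, fun k hk v => ?_⟩
  obtain ⟨k, rfl⟩ := Nat.exists_eq_add_of_le' (show 1 ≤ k by omega)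
  have hpow : Q ≤ X.N ^ k :=
    (show Q ≤ k by omega).trans ((Nat.lt_pow_self (by omega : 1 < X.N)).le)
  have hle : X.N ^ k ≤ X.N ^ (k + 1) := Nat.pow_le_pow_right hN0 (Nat.le_succ k)
  have hMM : M ≤ M ^ 2 := Nat.le_self_pow two_ne_zero M
  have hMN : M ≤ X.N ^ (k + 1) := by omega
  have hterm : ∀ v, X.IsTerminal (X.type v) → ∀ j, 0 < j → j ≤ X.N ^ (k + 1) →
      ShiftEquiv 5 (paths (X.iter (k + 1)) {v}) (words (X.N ^ (k + 1)) j) := by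
    intro v hv j hj hjN
    have h1 := hX.isTerminal_shiftEquiv hN hM hR (k := k) (by omega) (by omega) (by omega) hv
    have hvv : X.Rel (X.type v) (X.type v) := by
      obtain ⟨u, hu⟩ := exists_mem_ch hN0 v
      have h : X.Rel (X.type v) (X.type u) := ⟨v, u, hu, rfl, rfl⟩
      exact hX.trans h (hv _ h)
    refine h1.trans (shiftEquiv_words ?_ ?_ hj hjN)
    · exact Nat.div_pos (Nat.le_of_dvd (X.wt_pos v) (Finset.gcd_dvd (mem_reach.2 hvv)))
        (gcd_reach_pos hN0 v)
    · exact (Nat.div_le_self _ _).trans ((hM _).trans hMN)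
  by_cases hv : X.IsTerminal (X.type v)
  · exact (hterm v hv 1 one_pos (Nat.pow_pos hN0)).mono (by norm_num)
  · refine (hX.not_isTerminal_shiftEquiv (k := k + 1) hN0 hM hM0 (by omega) (by omega)
      (hk₁ _ (by omega)) hterm hv).trans (shiftEquiv_words_one (by positivity) ?_)
    omega

/-- The spaces of paths in a forest with finitely many types are equivalent to the space of words,
if only the generations that are multiples of a suitable number are considered. -/
theorem exists_shiftEquiv [Finite ι] (X : TypedForest V ι) (hN : 2 ≤ X.N) :
    ∃ P > 0, ∀ m > 0, ∀ v,
      ShiftEquiv 8 (paths (X.iter (P * m)) {v}) (words (X.N ^ (P * m)) 1) := by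
  obtain ⟨p, hp, hstab⟩ := X.exists_rel_pow_eq
  have hX : (X.pow p).IsStable := by
    intro k hk
    rw [← hstab k hk]
    funext t s
    change (∃ v, ∃ u ∈ (X.pow p).iter k v, _) = _
    rw [iter_pow]
    rfl
  obtain ⟨k₀, hk₀⟩ := hX.exists_shiftEquiv
    (show 2 ≤ X.N ^ p from hN.trans (Nat.le_self_pow hp.ne' _))
  refine ⟨p * (k₀ + 1), by positivity, fun m hm v => ?_⟩
  have := hk₀ ((k₀ + 1) * m) (by nlinarith) v
  rw [iter_pow, show (X.pow p).N = X.N ^ p from rfl, ← pow_mul, ← mul_assoc] at this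
  exact this

end TypedForest

/-! ### Horizontal components of an augmented tree as a typed forest -/

namespace AugmentedTree

variable {V : Type} {X : AugmentedTree V}

/-- The horizontal component of a vertex. -/
abbrev comp (X : AugmentedTree V) (x : V) : X.HorizontalComponent :=
  X.horiz.connectedComponentMk x

theorem reachable_pred {x y : V} (h : X.horiz.Reachable x y) :
    X.horiz.Reachable (X.pred x) (X.pred y) := by
  obtain ⟨w⟩ := h
  induction w with
  | nil => exact SimpleGraph.Reachable.refl _
  | cons hadj _ ih =>
    refine SimpleGraph.Reachable.trans ?_ ih
    rcases X.horiz_pred _ _ hadj with h | h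
    · rw [h]
    · exact h.reachable

theorem level_eq_of_reachable {x y : V} (h : X.horiz.Reachable x y) : X.level x = X.level y := by
  obtain ⟨w⟩ := h
  induction w with
  | nil => rfl
  | cons hadj _ ih => exact (X.horiz_level _ _ hadj).trans ih

theorem eq_root_of_level_eq_zero {x : V} (h : X.level x = 0) : x = X.root := by
  by_contra hx
  have := X.level_eq x hx
  omega

theorem level_pred_iterate (k : ℕ) (x : V) : X.level (X.pred^[k] x) = X.level x - k := by
  induction k generalizing x with
  | zero => rfl
  | succ k ih =>
    rw [Function.iterate_succ_apply, ih]
    by_cases hx : x = X.root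
    · rw [hx, X.pred_root, X.level_root]
      omega
    · have := X.level_eq x hx
      omega

/-- The predecessor of a horizontal component. -/
def compPred (X : AugmentedTree V) : X.HorizontalComponent → X.HorizontalComponent :=
  Quot.map X.pred fun _ _ h => reachable_pred h

/-- The level of a horizontal component. -/
def compLevel (X : AugmentedTree V) : X.HorizontalComponent → ℕ :=
  Quot.lift X.level fun _ _ h => level_eq_of_reachable h

theorem compPred_comp (x : V) : X.compPred (X.comp x) = X.comp (X.pred x) := rfl

theorem compLevel_comp (x : V) : X.compLevel (X.comp x) = X.level x := rfl

theorem comp_eq_comp {x y : V} : X.comp x = X.comp y ↔ X.horiz.Reachable x y :=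
  SimpleGraph.ConnectedComponent.eq

theorem mem_supp {T : X.HorizontalComponent} {x : V} : x ∈ T.supp ↔ X.comp x = T :=
  SimpleGraph.ConnectedComponent.mem_supp_iff T x

theorem comp_eq_comp_root {x : V} : X.comp x = X.comp X.root ↔ x = X.root := by
  refine ⟨fun h => eq_root_of_level_eq_zero ?_, fun h => by rw [h]⟩
  rw [level_eq_of_reachable (comp_eq_comp.1 h), X.level_root]

theorem level_of_mem_supp {T : X.HorizontalComponent} {x : V} (h : x ∈ T.supp) :
    X.level x = X.compLevel T := by
  rw [← mem_supp.1 h, compLevel_comp]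

section Descendants

variable {T T' : X.HorizontalComponent}

theorem mem_descendants {x : V} : x ∈ X.descendants T ↔ ∃ k : ℕ, X.comp (X.pred^[k] x) = T := by
  simp only [descendants, Set.mem_ofPred_eq, mem_supp]

theorem supp_subset_descendants : T.supp ⊆ X.descendants T := fun _ hx => ⟨0, hx⟩

theorem mem_descendants_of_reachable {x y : V} (h : X.horiz.Reachable x y)
    (hx : x ∈ X.descendants T) : y ∈ X.descendants T := by
  obtain ⟨k, hk⟩ := mem_descendants.1 hx
  refine mem_descendants.2 ⟨k, hk ▸ ?_⟩
  rw [comp_eq_comp]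
  clear hx hk
  induction k generalizing x y with
  | zero => exact h.symm
  | succ k ih => exact ih (reachable_pred h)

theorem mem_descendants_of_iterate {k : ℕ} {x : V} (h : X.pred^[k] x ∈ X.descendants T) :
    x ∈ X.descendants T := by
  obtain ⟨j, hj⟩ := h
  exact ⟨j + k, by rwa [Function.iterate_add_apply]⟩

/-- This describes `T` inside its descendants by vertical edges alone, as the vertices without a
parent there, so an equivalence must carry `T` onto `T'`. -/
theorem mem_supp_iff_forall_not {x : V} (hx : x ∈ X.descendants T) :
    x ∈ T.supp ↔ ∀ y ∈ X.descendants T, ¬ X.IsVerticalEdge y x := by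
  constructor
  · rintro h y ⟨k, hk⟩ ⟨hxr, rfl⟩
    have h1 := level_of_mem_supp hk
    rw [level_pred_iterate, ← level_of_mem_supp h, X.level_eq x hxr] at h1
    omega
  · intro h
    obtain ⟨k, hk⟩ := hx
    induction k with
    | zero => exact hk
    | succ k ih =>
      by_cases hxr : x = X.root
      · have h1 : ∀ k, X.pred^[k] X.root = X.root := fun k =>
          Function.iterate_fixed X.pred_root k
        rw [hxr, h1] at hk
        rwa [hxr]
      · exact absurd ⟨hxr, rfl⟩ (h (X.pred x) ⟨k, hk⟩)

variable {g : X.descendants T ≃ X.descendants T'}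

theorem mem_supp_iff_map
    (hv : ∀ x y : X.descendants T, X.IsVerticalEdge x y ↔ X.IsVerticalEdge (g x : V) (g y : V))
    (x : X.descendants T) : (x : V) ∈ T.supp ↔ (g x : V) ∈ T'.supp := by
  rw [mem_supp_iff_forall_not x.2, mem_supp_iff_forall_not (g x).2]
  constructor
  · intro h y hy hyx
    refine h (g.symm ⟨y, hy⟩) (Subtype.mem _) ?_
    rw [hv]
    simpa using hyx
  · intro h y hy hyx
    exact h (g ⟨y, hy⟩) (Subtype.mem _) ((hv ⟨y, hy⟩ x).1 hyx)

theorem reachable_map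
    (hh : ∀ x y : X.descendants T, X.horiz.Adj (x : V) y ↔ X.horiz.Adj (g x : V) (g y : V))
    {x y : V} (h : X.horiz.Reachable x y) (hx : x ∈ X.descendants T) (hy : y ∈ X.descendants T) :
    X.horiz.Reachable (g ⟨x, hx⟩ : V) (g ⟨y, hy⟩ : V) := by
  obtain ⟨w⟩ := h
  induction w with
  | nil => exact SimpleGraph.Reachable.refl _
  | @cons u v w hadj _ ih =>
    have hz := mem_descendants_of_reachable hadj.reachable hx
    exact ((hh ⟨u, hx⟩ ⟨v, hz⟩).1 hadj).reachable.trans (ih hz hy)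

theorem map_mem_descendants
    (hv : ∀ x y : X.descendants T, X.IsVerticalEdge x y ↔ X.IsVerticalEdge (g x : V) (g y : V))
    (hh : ∀ x y : X.descendants T, X.horiz.Adj (x : V) y ↔ X.horiz.Adj (g x : V) (g y : V))
    (x : X.descendants T) {y : V} (hy : y ∈ X.descendants (X.comp x))
    (hyT : y ∈ X.descendants T) :
    (g ⟨y, hyT⟩ : V) ∈ X.descendants (X.comp (g x)) := by
  obtain ⟨k, hk⟩ := hy
  induction k generalizing y with
  | zero => exact ⟨0, mem_supp.2 (comp_eq_comp.2
      (reachable_map hh (comp_eq_comp.1 (mem_supp.1 hk)) hyT x.2))⟩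
  | succ k ih =>
    by_cases hyr : y = X.root
    · refine ih hyT ?_
      have h1 : ∀ k, X.pred^[k] X.root = X.root := fun k => Function.iterate_fixed X.pred_root k
      rw [hyr, h1] at hk ⊢
      exact hk
    · have h2 : X.pred y ∈ X.descendants T := by
        refine mem_descendants_of_iterate (k := k) ?_
        exact mem_descendants_of_reachable (comp_eq_comp.1 (mem_supp.1 hk)).symm x.2
      obtain ⟨j, hj⟩ := ih h2 hk
      have h3 := (hv ⟨_, h2⟩ ⟨y, hyT⟩).1 ⟨hyr, rfl⟩
      exact ⟨j + 1, by rw [Function.iterate_succ_apply, h3.2]; exact hj⟩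

theorem descendants_comp_subset {x : V} (hx : x ∈ X.descendants T) :
    X.descendants (X.comp x) ⊆ X.descendants T := by
  rintro y ⟨k, hk⟩
  exact mem_descendants_of_iterate (k := k)
    (mem_descendants_of_reachable (comp_eq_comp.1 (mem_supp.1 hk)).symm hx)

/-- The restriction of an equivalence to the descendants of a smaller component is again an
equivalence. Hence the type of a component determines the types of its offspring. -/
theorem equivalent_comp
    (hv : ∀ x y : X.descendants T, X.IsVerticalEdge x y ↔ X.IsVerticalEdge (g x : V) (g y : V))
    (hh : ∀ x y : X.descendants T, X.horiz.Adj (x : V) y ↔ X.horiz.Adj (g x : V) (g y : V))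
    (x : X.descendants T) : X.Equivalent (X.comp x) (X.comp (g x)) := by
  have hs := descendants_comp_subset x.2
  have hs' := descendants_comp_subset (g x).2
  have hv' : ∀ x y : X.descendants T', X.IsVerticalEdge x y ↔
      X.IsVerticalEdge (g.symm x : V) (g.symm y : V) := fun x y => by
    simpa using (hv (g.symm x) (g.symm y)).symm
  have hh' : ∀ x y : X.descendants T', X.horiz.Adj x y ↔
      X.horiz.Adj (g.symm x : V) (g.symm y : V) := fun x y => by
    simpa using (hh (g.symm x) (g.symm y)).symm
  refine ⟨⟨fun y => ⟨g ⟨y, hs y.2⟩, map_mem_descendants hv hh x y.2 _⟩,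
    fun y => ⟨g.symm ⟨y, hs' y.2⟩, ?_⟩, fun y => ?_, fun y => ?_⟩,
    fun y z => hv ⟨y, hs y.2⟩ ⟨z, hs z.2⟩,
    fun y z => hh ⟨y, hs y.2⟩ ⟨z, hs z.2⟩⟩
  · have := map_mem_descendants hv' hh' (g x) y.2 (hs' y.2)
    rwa [g.symm_apply_apply] at this
  · simp
  · simp

theorem Equivalent.ncard_eq (h : X.Equivalent T T') : T.supp.ncard = T'.supp.ncard := by
  obtain ⟨g, hv, -⟩ := h
  refine Set.ncard_congr (fun x hx => (g ⟨x, supp_subset_descendants hx⟩ : V))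
    (fun x hx => (mem_supp_iff_map hv _).1 hx) (fun x y hx hy hxy => ?_) fun y hy => ?_
  · simpa using g.injective (Subtype.ext hxy)
  · refine ⟨g.symm ⟨y, supp_subset_descendants hy⟩, ?_, by simp⟩
    rw [mem_supp_iff_map hv]
    simpa using hy

theorem Equivalent.exists_compPred_eq (h : X.Equivalent T T') {U : X.HorizontalComponent}
    (hU : X.compPred U = T) (hUr : U ≠ X.comp X.root) :
    ∃ U', X.compPred U' = T' ∧ U' ≠ X.comp X.root ∧ X.Equivalent U U' := by
  obtain ⟨g, hv, hh⟩ := h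
  induction U using SimpleGraph.ConnectedComponent.ind with
  | h x =>
    have hx : x ∈ X.descendants T := ⟨1, mem_supp.2 hU⟩
    have hpx : X.pred x ∈ X.descendants T := ⟨0, mem_supp.2 hU⟩
    have hxr : x ≠ X.root := fun h => hUr (comp_eq_comp_root.2 h)
    have h1 := (hv ⟨_, hpx⟩ ⟨x, hx⟩).1 ⟨hxr, rfl⟩
    have h2 := (mem_supp_iff_map hv ⟨_, hpx⟩).1 (mem_supp.2 hU)
    refine ⟨X.comp (g ⟨x, hx⟩), ?_, fun h => h1.1 (comp_eq_comp_root.1 h),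
      equivalent_comp hv hh ⟨x, hx⟩⟩
    rw [compPred_comp, h1.2]
    exact mem_supp.1 h2

end Descendants

section Forest

theorem finite_level (hfin : ∀ x, {y | X.IsVerticalEdge x y}.Finite) (n : ℕ) :
    {x | X.level x = n}.Finite := by
  induction n with
  | zero => exact (Set.finite_singleton X.root).subset fun x hx => eq_root_of_level_eq_zero hx
  | succ n ih =>
    refine (ih.biUnion fun x _ => hfin x).subset fun y hy => ?_
    have hyr : y ≠ X.root := by
      rintro rfl
      simp [X.level_root] at hy
    refine Set.mem_biUnion (x := X.pred y) ?_ ⟨hyr, rfl⟩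
    have h1 := X.level_eq y hyr
    simp only [Set.mem_ofPred_eq] at hy ⊢
    omega

theorem finite_supp (hfin : ∀ x, {y | X.IsVerticalEdge x y}.Finite)
    (T : X.HorizontalComponent) : T.supp.Finite :=
  (finite_level hfin (X.compLevel T)).subset fun _ hx => level_of_mem_supp hx

variable (hfin : ∀ x, {y | X.IsVerticalEdge x y}.Finite)

open Classical in
/-- The offspring of a horizontal component. -/
noncomputable def compChildren (T : X.HorizontalComponent) : Finset X.HorizontalComponent :=
  ((finite_supp hfin T).toFinset.biUnion fun x => (hfin x).toFinset).image X.comp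

theorem mem_compChildren {T U : X.HorizontalComponent} :
    U ∈ compChildren hfin T ↔ X.compPred U = T ∧ U ≠ X.comp X.root := by
  simp only [compChildren, Finset.mem_image, Finset.mem_biUnion, Set.Finite.mem_toFinset,
    Set.mem_ofPred_eq, mem_supp]
  constructor
  · rintro ⟨y, ⟨x, rfl, hy, rfl⟩, rfl⟩
    exact ⟨rfl, fun h => hy (comp_eq_comp_root.1 h)⟩
  · induction U using SimpleGraph.ConnectedComponent.ind with
    | h y =>
      rintro ⟨rfl, hy⟩
      exact ⟨y, ⟨X.pred y, rfl, fun h => hy (comp_eq_comp_root.2 h), rfl⟩, rfl⟩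

theorem sum_compChildren {N : ℕ} (T : X.HorizontalComponent)
    (hN : ∀ x ∈ T.supp, {y | X.IsVerticalEdge x y}.ncard = N) :
    ∑ U ∈ compChildren hfin T, U.supp.ncard = N * T.supp.ncard := by
  classical
  have h1 : ((compChildren hfin T).biUnion fun U => (finite_supp hfin U).toFinset) =
      (finite_supp hfin T).toFinset.biUnion fun x => (hfin x).toFinset := by
    ext y
    simp only [Finset.mem_biUnion, Set.Finite.mem_toFinset, mem_compChildren, mem_supp,
      Set.mem_ofPred_eq]
    constructor
    · rintro ⟨_, ⟨rfl, hr⟩, rfl⟩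
      exact ⟨X.pred y, rfl, fun h => hr (comp_eq_comp_root.2 h), rfl⟩
    · rintro ⟨_, rfl, hy, rfl⟩
      exact ⟨X.comp y, ⟨rfl, fun h => hy (comp_eq_comp_root.1 h)⟩, rfl⟩
  have h2 := congrArg Finset.card h1
  rw [Finset.card_biUnion, Finset.card_biUnion] at h2
  · simp only [← Set.ncard_eq_toFinset_card] at h2
    rw [h2, Finset.sum_congr rfl fun x hx => hN x ((Set.Finite.mem_toFinset _).1 hx),
      Finset.sum_const, smul_eq_mul, mul_comm, ← Set.ncard_eq_toFinset_card _ (finite_supp hfin T)]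
  · intro x _ x' _ hxx
    rw [Function.onFun, Finset.disjoint_left]
    intro y hy hy'
    rw [Set.Finite.mem_toFinset] at hy hy'
    exact hxx (hy.2.symm.trans hy'.2)
  · intro x _ x' _ hxx
    rw [Function.onFun, Finset.disjoint_left]
    intro y hy hy'
    rw [Set.Finite.mem_toFinset, mem_supp] at hy hy'
    exact hxx (hy.symm.trans hy')

open Classical in
/-- The forest of the horizontal components apart from the root. -/
noncomputable def forest {N : ℕ} (hN : ∀ x ≠ X.root, {y | X.IsVerticalEdge x y}.ncard = N) :
    TypedForest {T : X.HorizontalComponent // T ≠ X.comp X.root} (Quotient X.componentSetoid) where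
  ch T := (compChildren hfin T.1).subtype _
  eq_of_mem T T' U h h' := by
    rw [Finset.mem_subtype, mem_compChildren] at h h'
    exact Subtype.ext (h.1.symm.trans h'.1)
  type T := Quotient.mk X.componentSetoid T.1
  wt := Quotient.lift (fun T => T.supp.ncard) fun _ _ h => h.ncard_eq
  wt_pos T := by
    change 0 < T.1.supp.ncard
    rw [Set.ncard_pos (finite_supp hfin _)]
    exact T.1.nonempty_supp
  N := N
  sum_wt T := by
    change ∑ U ∈ (compChildren hfin T.1).subtype _, U.1.supp.ncard = N * T.1.supp.ncard
    rw [← sum_compChildren hfin T.1 fun x hx => hN x fun h => T.2 (by rw [← mem_supp.1 hx, h])]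
    exact Finset.sum_subtype_of_mem (p := (· ≠ X.comp X.root))
      (fun U : X.HorizontalComponent => U.supp.ncard) fun U hU => ((mem_compChildren hfin).1 hU).2
  exists_type_eq T T' h U hU := by
    rw [Finset.mem_subtype, mem_compChildren] at hU
    have h1 : X.Equivalent T.1 T'.1 := Quotient.exact h
    obtain ⟨U', h2, h3, h4⟩ := h1.exists_compPred_eq hU.1 hU.2
    refine ⟨⟨U', h3⟩, ?_, Quotient.sound (Setoid.symm' _ h4)⟩
    rw [Finset.mem_subtype, mem_compChildren]
    exact ⟨h2, h3⟩

theorem mem_forest_ch {N : ℕ} (hN : ∀ x ≠ X.root, {y | X.IsVerticalEdge x y}.ncard = N)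
    {T U : {T : X.HorizontalComponent // T ≠ X.comp X.root}} :
    U ∈ (forest hfin hN).ch T ↔ X.compPred U.1 = T.1 := by
  classical
  change U ∈ (compChildren hfin T.1).subtype _ ↔ _
  rw [Finset.mem_subtype, mem_compChildren]
  exact and_iff_left U.2

theorem exists_ncard_supp_le (hX : X.IsSimple) : ∃ M, ∀ T : X.HorizontalComponent,
    T.supp.ncard ≤ M := by
  have : Finite (Quotient X.componentSetoid) := hX
  let wt : Quotient X.componentSetoid → ℕ :=
    Quotient.lift (fun T => T.supp.ncard) fun _ _ h => h.ncard_eq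
  obtain ⟨M, hM⟩ := (Set.finite_range wt).bddAbove
  exact ⟨M, fun T => hM ⟨Quotient.mk _ T, rfl⟩⟩

end Forest

end AugmentedTree

/-! ### Cell systems: from points to paths of components to words -/

/-- A family of compact sets indexed by the vertices of an augmented tree, such that the set of a
vertex is the union of the sets of its offspring, horizontal edges join the different vertices of
one level whose sets intersect, and sets of level `n` have diameters at most of the order `r ^ n`
and distances at least of the order `r ^ n`, if they are disjoint. -/
structure IsCellSystem {V E : Type} [MetricSpace E] (X : AugmentedTree V) (cell : V → Set E)
    (N : ℕ) (r D c : ℝ) : Prop where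
  finite_offspring : ∀ x, {y | X.IsVerticalEdge x y}.Finite
  ncard_offspring : ∀ x ≠ X.root, {y | X.IsVerticalEdge x y}.ncard = N
  isCompact : ∀ x, IsCompact (cell x)
  nonempty : ∀ x, (cell x).Nonempty
  cell_eq : ∀ x, cell x = ⋃ y ∈ {y | X.IsVerticalEdge x y}, cell y
  adj_iff : ∀ x y, X.horiz.Adj x y ↔
    X.level x = X.level y ∧ x ≠ y ∧ (cell x ∩ cell y).Nonempty
  dist_le : ∀ x ≠ X.root, ∀ a ∈ cell x, ∀ b ∈ cell x, dist a b ≤ D * r ^ X.level x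
  le_dist : ∀ x y, X.level x = X.level y → 2 ≤ X.level x → Disjoint (cell x) (cell y) →
    ∀ a ∈ cell x, ∀ b ∈ cell y, c * r ^ X.level x ≤ dist a b

namespace IsCellSystem

open FilteredSet AugmentedTree

variable {V E : Type} [MetricSpace E] {X : AugmentedTree V} {cell : V → Set E} {N : ℕ} {r D c : ℝ}

theorem cell_subset_pred (h : IsCellSystem X cell N r D c) {x : V} :
    cell x ⊆ cell (X.pred x) := by
  by_cases hx : x = X.root
  · rw [hx, X.pred_root]
  · rw [h.cell_eq (X.pred x)]
    exact Set.subset_biUnion_of_mem (u := cell) (show X.IsVerticalEdge _ x from ⟨hx, rfl⟩)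

theorem cell_subset_root (h : IsCellSystem X cell N r D c) (x : V) : cell x ⊆ cell X.root := by
  obtain ⟨n, hn⟩ : ∃ n, X.level x = n := ⟨_, rfl⟩
  induction n generalizing x with
  | zero => rw [eq_root_of_level_eq_zero hn]
  | succ n ih =>
    refine h.cell_subset_pred.trans (ih _ ?_)
    have hx : x ≠ X.root := by
      rintro rfl
      rw [X.level_root] at hn
      omega
    have := X.level_eq x hx
    omega

theorem exists_level_eq (h : IsCellSystem X cell N r D c) {a : E} (ha : a ∈ cell X.root) (n : ℕ) :
    ∃ x, X.level x = n ∧ a ∈ cell x := by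
  induction n with
  | zero => exact ⟨X.root, X.level_root, ha⟩
  | succ n ih =>
    obtain ⟨x, hx, hax⟩ := ih
    rw [h.cell_eq] at hax
    obtain ⟨y, hy, hay⟩ := Set.mem_iUnion₂.1 hax
    refine ⟨y, ?_, hay⟩
    rw [X.level_eq y hy.1, hy.2, hx]

theorem comp_eq (h : IsCellSystem X cell N r D c) {a : E} {x y : V} (hl : X.level x = X.level y)
    (hx : a ∈ cell x) (hy : a ∈ cell y) : X.comp x = X.comp y := by
  rw [comp_eq_comp]
  by_cases hxy : x = y
  · rw [hxy]
  · exact ((h.adj_iff x y).2 ⟨hl, hxy, a, hx, hy⟩).reachable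

/-- The horizontal component of level `n` whose cells contain the point `a`. -/
noncomputable def compAt (h : IsCellSystem X cell N r D c) (n : ℕ) (a : cell X.root) :
    X.HorizontalComponent := X.comp (h.exists_level_eq a.2 n).choose

theorem compAt_eq (h : IsCellSystem X cell N r D c) {a : cell X.root} {x : V}
    (hx : (a : E) ∈ cell x) : h.compAt (X.level x) a = X.comp x :=
  h.comp_eq (h.exists_level_eq a.2 _).choose_spec.1 (h.exists_level_eq a.2 _).choose_spec.2 hx

theorem exists_compAt_eq (h : IsCellSystem X cell N r D c) (n : ℕ) (a : cell X.root) :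
    ∃ x, X.level x = n ∧ (a : E) ∈ cell x ∧ h.compAt n a = X.comp x :=
  ⟨_, (h.exists_level_eq a.2 n).choose_spec.1, (h.exists_level_eq a.2 n).choose_spec.2, rfl⟩

theorem compPred_compAt (h : IsCellSystem X cell N r D c) (n : ℕ) (a : cell X.root) :
    X.compPred (h.compAt (n + 1) a) = h.compAt n a := by
  obtain ⟨x, hx, hax, hc⟩ := h.exists_compAt_eq (n + 1) a
  have hxr : x ≠ X.root := by
    rintro rfl
    rw [X.level_root] at hx
    omega
  have h1 := X.level_eq x hxr
  rw [hc, compPred_comp, ← h.compAt_eq (h.cell_subset_pred hax)]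
  congr 1
  omega

theorem compAt_ne (h : IsCellSystem X cell N r D c) (n : ℕ) (a : cell X.root) :
    h.compAt (1 + n) a ≠ X.comp X.root := by
  obtain ⟨x, hx, -, hc⟩ := h.exists_compAt_eq (1 + n) a
  rw [hc, Ne, comp_eq_comp_root]
  rintro rfl
  rw [X.level_root] at hx
  omega

theorem compAt_eq_of_le (h : IsCellSystem X cell N r D c) {m n : ℕ} (hmn : m ≤ n)
    {a b : cell X.root} (hab : h.compAt n a = h.compAt n b) : h.compAt m a = h.compAt m b := by
  induction hmn with
  | refl => exact hab
  | @step k _ ih =>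
    refine ih ?_
    rw [← h.compPred_compAt k a, ← h.compPred_compAt k b]
    exact congrArg _ hab

/-- Cells of one level that meet belong to one component, so cells in different components are
disjoint and the separation bound applies; that bound is available from level 2 on. -/
theorem le_dist_of_compAt_ne (h : IsCellSystem X cell N r D c) {n : ℕ} {a b : cell X.root}
    (hab : h.compAt (n + 2) a ≠ h.compAt (n + 2) b) : c * r ^ (n + 2) ≤ dist a b := by
  obtain ⟨x, hx, hax, hc⟩ := h.exists_compAt_eq (n + 2) a
  obtain ⟨y, hy, hby, hc'⟩ := h.exists_compAt_eq (n + 2) b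
  have hl : X.level x = X.level y := hx.trans hy.symm
  rw [← hx]
  refine h.le_dist x y hl (by omega) ?_ _ hax _ hby
  rw [Set.disjoint_iff_inter_eq_empty]
  by_contra hne
  obtain ⟨z, hzx, hzy⟩ := Set.nonempty_iff_ne_empty.2 hne
  exact hab (by rw [hc, hc', h.comp_eq hl hzx hzy])

/-- Consecutive cells along the walk meet, so the distance is at most the sum of the diameter bounds
of the `p.length + 1` cells. -/
theorem dist_le_of_walk (h : IsCellSystem X cell N r D c) {x y : V} (p : X.horiz.Walk x y)
    (hx : x ≠ X.root) {a b : E} (ha : a ∈ cell x) (hb : b ∈ cell y) :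
    dist a b ≤ (p.length + 1) * (D * r ^ X.level x) := by
  induction p generalizing a with
  | nil => simpa using h.dist_le _ hx _ ha _ hb
  | @cons u v w hadj p ih =>
    obtain ⟨hl, -, z, hzu, hzv⟩ := (h.adj_iff _ _).1 hadj
    have hv : v ≠ X.root := by
      rintro rfl
      rw [X.level_root] at hl
      exact hx (eq_root_of_level_eq_zero hl)
    have h1 := h.dist_le _ hx _ ha _ hzu
    have h2 := ih hv hzv hb
    rw [← hl] at h2
    have h3 := dist_triangle a z b
    rw [SimpleGraph.Walk.length_cons]
    push_cast
    linarith

theorem dist_le_of_compAt_eq (h : IsCellSystem X cell N r D c) (hr : 0 < r) (hD : 0 ≤ D) {M : ℕ}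
    (hM : ∀ T : X.HorizontalComponent, T.supp.ncard ≤ M) {n : ℕ} {a b : cell X.root}
    (hab : h.compAt (1 + n) a = h.compAt (1 + n) b) : dist a b ≤ M * D * r ^ (1 + n) := by
  classical
  obtain ⟨x, hx, hax, hc⟩ := h.exists_compAt_eq (1 + n) a
  obtain ⟨y, hy, hby, hc'⟩ := h.exists_compAt_eq (1 + n) b
  have hxy : X.horiz.Reachable x y := comp_eq_comp.1 (by rw [← hc, ← hc', hab])
  -- A path repeats no vertex, so its number of vertices is at most the size of the component.
  obtain ⟨p, hp⟩ := hxy.exists_isPath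
  have hxr : x ≠ X.root := by
    rintro rfl
    rw [X.level_root] at hx
    omega
  have h1 := h.dist_le_of_walk p hxr hax hby
  have h2 : p.length + 1 ≤ M := by
    rw [← p.length_support, ← List.toFinset_card_of_nodup hp.support_nodup]
    refine le_trans ?_ (hM (X.comp x))
    rw [Set.ncard_eq_toFinset_card _ (finite_supp h.finite_offspring _)]
    refine Finset.card_le_card fun z hz => ?_
    rw [Set.Finite.mem_toFinset, mem_supp]
    have h3 : X.horiz.Reachable x z := ⟨p.takeUntil z (List.mem_toFinset.1 hz)⟩
    exact (comp_eq_comp.2 h3).symm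
  rw [hx] at h1
  refine h1.trans ?_
  rw [mul_assoc]
  have h4 : ((p.length : ℝ) + 1) ≤ M := by exact_mod_cast h2
  gcongr

/-- The points of the cell of the root, filtered by the components that contain them. -/
def points (h : IsCellSystem X cell N r D c) (L : ℕ) : FilteredSet where
  carrier := cell X.root
  rel n a b := ∀ i ≤ n, h.compAt (1 + L * i) a = h.compAt (1 + L * i) b
  anti hmn _ _ hab := fun i hi => hab i (hi.trans hmn)

/-- The forest of the horizontal components of a cell system. -/
noncomputable abbrev compForest (h : IsCellSystem X cell N r D c) :=
  forest h.finite_offspring h.ncard_offspring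

/-- The union of the cells of a component. -/
def compCell (cell : V → Set E) (T : X.HorizontalComponent) : Set E := ⋃ x ∈ T.supp, cell x

theorem compCell_subset_compPred (h : IsCellSystem X cell N r D c) (T : X.HorizontalComponent) :
    compCell cell T ⊆ compCell cell (X.compPred T) := by
  refine Set.iUnion₂_subset fun x hx => h.cell_subset_pred.trans ?_
  refine Set.subset_biUnion_of_mem (u := cell) (mem_supp.2 ?_)
  rw [← mem_supp.1 hx, compPred_comp]

theorem compLevel_compPred {T : X.HorizontalComponent} (hT : T ≠ X.comp X.root) :
    X.compLevel T = X.compLevel (X.compPred T) + 1 := by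
  induction T using SimpleGraph.ConnectedComponent.ind with
  | h x => exact X.level_eq x fun h => hT (comp_eq_comp_root.2 h)

theorem compLevel_of_mem_iter (h : IsCellSystem X cell N r D c) {j : ℕ}
    {T U : {T : X.HorizontalComponent // T ≠ X.comp X.root}} (hU : U ∈ h.compForest.iter j T) :
    X.compLevel U.1 = X.compLevel T.1 + j ∧ compCell cell U.1 ⊆ compCell cell T.1 := by
  induction j generalizing U with
  | zero =>
    obtain rfl : U = T := by simpa [TypedForest.iter] using hU
    exact ⟨rfl, subset_rfl⟩
  | succ j ih =>
    obtain ⟨W, hW, hUW⟩ := (TypedForest.mem_iter_succ _).1 hU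
    rw [mem_forest_ch] at hUW
    obtain ⟨h1, h2⟩ := ih hW
    rw [compLevel_compPred U.2, hUW, h1]
    refine ⟨by ring, ?_⟩
    rw [← hUW] at h2
    exact (h.compCell_subset_compPred _).trans h2

theorem compAt_mem_iter (h : IsCellSystem X cell N r D c) (a : cell X.root) (n j : ℕ) :
    ⟨h.compAt (1 + (n + j)) a, h.compAt_ne _ a⟩ ∈
      h.compForest.iter j ⟨h.compAt (1 + n) a, h.compAt_ne n a⟩ := by
  induction j with
  | zero => simp [TypedForest.iter]
  | succ j ih =>
    refine (TypedForest.mem_iter_succ _).2 ⟨_, ih, ?_⟩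
    rw [mem_forest_ch]
    exact h.compPred_compAt _ a

theorem compAt_eq_of_mem (h : IsCellSystem X cell N r D c) {a : cell X.root}
    {T : X.HorizontalComponent} (ha : (a : E) ∈ compCell cell T) :
    h.compAt (X.compLevel T) a = T := by
  obtain ⟨x, hx, hax⟩ := Set.mem_iUnion₂.1 ha
  rw [← level_of_mem_supp hx, h.compAt_eq hax]
  exact mem_supp.1 hx

theorem isCompact_compCell (h : IsCellSystem X cell N r D c) (T : X.HorizontalComponent) :
    IsCompact (compCell cell T) :=
  (finite_supp h.finite_offspring T).isCompact_biUnion fun x _ => h.isCompact x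

theorem nonempty_compCell (h : IsCellSystem X cell N r D c) (T : X.HorizontalComponent) :
    (compCell cell T).Nonempty := by
  obtain ⟨x, hx⟩ := T.nonempty_supp
  exact (h.nonempty x).mono (Set.subset_biUnion_of_mem (u := cell) hx)

theorem compCell_subset_root (h : IsCellSystem X cell N r D c) (T : X.HorizontalComponent) :
    compCell cell T ⊆ cell X.root := Set.iUnion₂_subset fun x _ => h.cell_subset_root x

/-- Injectivity: points that share components at arbitrarily high levels have distance 0.
Surjectivity: the cells of the components along a path form a decreasing sequence of nonempty
compact sets. -/
theorem points_shiftEquiv_paths (h : IsCellSystem X cell N r D c) (hr : 0 < r) (hr1 : r < 1)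
    (hD : 0 ≤ D) (hX : X.IsSimple) {L : ℕ} (hL : 0 < L) :
    ShiftEquiv 0 (h.points L) (paths (h.compForest.iter L) {T | X.compLevel T.1 = 1}) := by
  obtain ⟨M, hM⟩ := exists_ncard_supp_le hX
  let f : (h.points L).carrier → (paths (h.compForest.iter L) {T | X.compLevel T.1 = 1}).carrier :=
    fun a => ⟨fun n => ⟨h.compAt (1 + L * n) a, h.compAt_ne _ a⟩, by
      obtain ⟨x, hx, -, hc⟩ := h.exists_compAt_eq (1 + L * 0) a
      change X.compLevel (h.compAt (1 + L * 0) a) = 1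
      rw [hc, compLevel_comp, hx, mul_zero, add_zero], fun n => h.compAt_mem_iter a (L * n) L⟩
  have hf : ∀ n (a b : cell X.root), (paths (h.compForest.iter L) {T | X.compLevel T.1 = 1}).rel n
      (f a) (f b) ↔ (h.points L).rel n a b := by
    intro n a b
    refine forall₂_congr fun i _ => ?_
    exact Subtype.ext_iff
  have hinj : Function.Injective f := by
    intro (a : cell X.root) (b : cell X.root) hab
    have h1 : ∀ n, dist a b ≤ M * D * r ^ (1 + L * n) := fun n =>
      h.dist_le_of_compAt_eq hr hD hM ((hf n a b).1 (fun i _ => by rw [hab]) n le_rfl)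
    have h2 : Filter.Tendsto (fun n : ℕ => M * D * r ^ (1 + L * n)) Filter.atTop (nhds 0) := by
      have h3 : Filter.Tendsto (fun n : ℕ => 1 + L * n) Filter.atTop Filter.atTop :=
        Filter.tendsto_atTop_mono
          (fun n => (Nat.le_mul_of_pos_left n hL).trans (Nat.le_add_left _ 1))
          Filter.tendsto_id
      simpa using ((tendsto_pow_atTop_nhds_zero_of_lt_one hr.le hr1).comp h3).const_mul (M * D)
    have h3 : a = b := dist_le_zero.1 (ge_of_tendsto' h2 h1)
    exact h3
  have hsurj : Function.Surjective f := by
    rintro ⟨p, hp0, hp⟩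
    have hlev : ∀ n, X.compLevel (p n).1 = 1 + L * n := by
      intro n
      induction n with
      | zero => exact hp0
      | succ n ih => rw [(h.compLevel_of_mem_iter (hp n)).1, ih]; ring
    obtain ⟨a, ha⟩ := IsCompact.nonempty_iInter_of_sequence_nonempty_isCompact_isClosed
      (fun n => compCell cell (p n).1) (fun n => (h.compLevel_of_mem_iter (hp n)).2)
      (fun n => h.nonempty_compCell _) (h.isCompact_compCell _)
      (fun n => (h.isCompact_compCell _).isClosed)
    rw [Set.mem_iInter] at ha
    refine ⟨⟨a, h.compCell_subset_root _ (ha 0)⟩, Subtype.ext (funext fun n => Subtype.ext ?_)⟩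
    change h.compAt (1 + L * n) _ = _
    rw [← hlev n]
    exact h.compAt_eq_of_mem (ha n)
  exact ⟨Equiv.ofBijective f ⟨hinj, hsurj⟩, fun n a b => ⟨(hf n a b).2, (hf n a b).1⟩⟩

theorem points_shiftEquiv_words (h : IsCellSystem X cell N r D c) (hN : 2 ≤ N) (hr : 0 < r)
    (hr1 : r < 1) (hD : 0 ≤ D) (hX : X.IsSimple) :
    ∃ P > 0, ∀ m > 0, ShiftEquiv 10 (h.points (P * m)) (words (N ^ (P * m)) 1) := by
  classical
  have : Finite (Quotient X.componentSetoid) := hX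
  obtain ⟨P, hP, hPw⟩ := h.compForest.exists_shiftEquiv hN
  have hfin' : {T | X.compLevel T = 1}.Finite := by
    refine ((finite_level h.finite_offspring 1).image X.comp).subset fun T hT => ?_
    obtain ⟨x, hx⟩ := T.nonempty_supp
    exact ⟨x, (level_of_mem_supp hx).trans hT, mem_supp.1 hx⟩
  have hfin : {T : {T : X.HorizontalComponent // T ≠ X.comp X.root} | X.compLevel T.1 = 1}.Finite :=
    hfin'.preimage Subtype.val_injective.injOn
  set s := hfin.toFinset
  have hs : s.Nonempty := by
    obtain ⟨a, ha⟩ := h.nonempty X.root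
    refine ⟨⟨h.compAt (1 + 0) ⟨a, ha⟩, h.compAt_ne _ _⟩, ?_⟩
    obtain ⟨x, hx, -, hc⟩ := h.exists_compAt_eq (1 + 0) ⟨a, ha⟩
    rw [Set.Finite.mem_toFinset]
    change X.compLevel (h.compAt (1 + 0) ⟨a, ha⟩) = 1
    rw [hc, compLevel_comp, hx]
  -- The factor `s.card` makes the alphabet at least as large as the number of components of level
  -- 1, as needed to merge that many copies of the word space.
  refine ⟨P * s.card, Nat.mul_pos hP (Finset.card_pos.2 hs), fun m hm => ?_⟩
  have hL : 0 < P * s.card * m := Nat.mul_pos (Nat.mul_pos hP (Finset.card_pos.2 hs)) hm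
  have h1 := h.points_shiftEquiv_paths hr hr1 hD hX hL
  have hpos : 0 < N ^ (P * s.card * m) := Nat.pow_pos (by omega)
  have h2 := ShiftEquiv.of_forall_mem (ch := h.compForest.iter (P * s.card * m)) hpos s
    fun v _ => by
      have := hPw (s.card * m) (Nat.mul_pos (Finset.card_pos.2 hs) hm) v
      rw [← mul_assoc] at this
      exact this
  rw [Set.Finite.coe_toFinset] at h2
  refine (h1.trans h2).trans (shiftEquiv_words_one (Finset.card_pos.2 hs) ?_)
  calc s.card ≤ P * s.card * m := by
        rw [mul_right_comm]
        exact Nat.le_mul_of_pos_left _ (Nat.mul_pos hP hm)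
    _ ≤ _ := (Nat.lt_pow_self (by omega : 1 < N)).le

/-- The cell of the root can be coded by infinite words such that the distance of two points is
comparable to a power of `r` given by the first digit in which their words differ. -/
theorem exists_coding (h : IsCellSystem X cell N r D c) (hN : 2 ≤ N) (hr : 0 < r)
    (hr1 : r < 1) (hD : 0 ≤ D) (hc : 0 < c) (hX : X.IsSimple) :
    ∃ P > 0, ∀ m > 0, ∃ f : cell X.root ≃ (ℕ → Fin (N ^ (P * m))), ∃ C > 0, ∀ a b n,
      ((∀ i < n, f a i = f b i) → dist a b ≤ C * (r ^ (P * m)) ^ n) ∧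
      ((∃ i < n, f a i ≠ f b i) → (r ^ (P * m)) ^ n ≤ C * dist a b) := by
  obtain ⟨M, hM⟩ := exists_ncard_supp_le hX
  obtain ⟨P, hP, hPw⟩ := h.points_shiftEquiv_words hN hr hr1 hD hX
  refine ⟨P, hP, fun m hm => ?_⟩
  have hw := hPw m hm
  have hL : 0 < P * m := Nat.mul_pos hP hm
  generalize P * m = L at hw hL ⊢
  obtain ⟨f, hf⟩ : ∃ f : cell X.root ≃ Fin 1 × (ℕ → Fin (N ^ L)),
      ∀ (n : ℕ) (a b : cell X.root), ((h.points L).rel (n + 10) a b →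
        (f a).1 = (f b).1 ∧ ∀ i < n, (f a).2 i = (f b).2 i) ∧
      (((f a).1 = (f b).1 ∧ ∀ i < n + 10, (f a).2 i = (f b).2 i) →
        (h.points L).rel n a b) := hw
  set ρ := r ^ L
  have hρ : 0 < ρ := pow_pos hr L
  have hρ1 : ρ ≤ 1 := pow_le_one₀ hr.le hr1.le
  set B := Metric.diam (cell X.root)
  have hB : 0 ≤ B := Metric.diam_nonneg
  have hMD : 0 ≤ M * D := by positivity
  -- The factor `ρ ^ 10` pays for the level shift, the diameter `B` covers `n < 10`, and `c * r ^ 2`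
  -- comes from comparing components two levels further down.
  refine ⟨f.trans (Equiv.uniqueProd _ _), (M * D + B) / ρ ^ 10 + 1 / (c * r ^ 2 * ρ ^ 10),
    by positivity, fun a b n => ⟨fun hab => ?_, ?_⟩⟩
  · change ∀ i < n, (f a).2 i = (f b).2 i at hab
    have h1 : dist a b ≤ (M * D + B) / ρ ^ 10 * ρ ^ n := by
      rw [div_mul_eq_mul_div, le_div_iff₀ (by positivity)]
      rcases lt_or_ge n 10 with hn | hn
      · have h2 : dist a b ≤ B := Metric.dist_le_diam_of_mem (h.isCompact _).isBounded a.2 b.2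
        calc dist a b * ρ ^ 10 ≤ B * ρ ^ n :=
              mul_le_mul h2 (pow_le_pow_of_le_one hρ.le hρ1 hn.le) (by positivity) hB
          _ ≤ _ := by gcongr; linarith
      · obtain ⟨n, rfl⟩ := Nat.exists_eq_add_of_le' hn
        have h2 := (hf n a b).2 ⟨Subsingleton.elim _ _, hab⟩ n le_rfl
        have h3 := h.dist_le_of_compAt_eq hr hD hM h2
        calc dist a b * ρ ^ 10 ≤ M * D * r ^ (1 + L * n) * ρ ^ 10 := by gcongr
          _ = M * D * ρ ^ (n + 10) * r := by rw [pow_add, pow_mul, pow_add]; ring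
          _ ≤ M * D * ρ ^ (n + 10) := mul_le_of_le_one_right (by positivity) hr1.le
          _ ≤ _ := by gcongr; linarith
    refine h1.trans ?_
    gcongr
    exact le_add_of_nonneg_right (by positivity)
  · rintro ⟨i, hi, hne⟩
    change (f a).2 i ≠ (f b).2 i at hne
    have h1 : ¬ (h.points L).rel (n + 10) a b := fun h2 => hne (((hf n a b).1 h2).2 i hi)
    -- The level `L * (n + 10) + 2` lies below every level `1 + L * j` with `j ≤ n + 10` and is at
    -- least 2, as the separation bound requires.
    have h2 : h.compAt (L * (n + 10) + 2) a ≠ h.compAt (L * (n + 10) + 2) b := by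
      refine fun h3 => h1 fun j hj => h.compAt_eq_of_le ?_ h3
      have := Nat.mul_le_mul_left L hj
      omega
    have h3 := h.le_dist_of_compAt_ne h2
    have h4 : c * r ^ (L * (n + 10) + 2) = c * r ^ 2 * ρ ^ 10 * ρ ^ n := by
      rw [pow_add, pow_mul, pow_add]; ring
    rw [h4] at h3
    have h5 : ρ ^ n ≤ 1 / (c * r ^ 2 * ρ ^ 10) * dist a b := by
      rw [div_mul_eq_mul_div, one_mul, le_div_iff₀ (by positivity)]
      linarith
    refine h5.trans ?_
    gcongr
    exact le_add_of_nonneg_left (by positivity)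

end IsCellSystem

/-! ### From two codings to a bi-Lipschitz bijection -/

/-- If the words of two points first differ at place `n`, their distance is between constant
multiples of `ρ ^ (n + 1)` and `ρ ^ n`, in `A` and in `B` alike. The quotient of these two powers is
the `ρ` in the constant. -/
theorem LipschitzEquivalent.of_codings {E : Type} [MetricSpace E] {A B : Set E} {N : ℕ} {ρ : ℝ}
    (hρ : 0 < ρ) {f : A ≃ (ℕ → Fin N)} {g : B ≃ (ℕ → Fin N)} {C C' : ℝ} (hC : 0 < C) (hC' : 0 < C')
    (hf : ∀ a b n, ((∀ i < n, f a i = f b i) → dist a b ≤ C * ρ ^ n) ∧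
      ((∃ i < n, f a i ≠ f b i) → ρ ^ n ≤ C * dist a b))
    (hg : ∀ a b n, ((∀ i < n, g a i = g b i) → dist a b ≤ C' * ρ ^ n) ∧
      ((∃ i < n, g a i ≠ g b i) → ρ ^ n ≤ C' * dist a b)) : LipschitzEquivalent A B := by
  have key : ∀ a b, a ≠ b → ∃ n, (∀ i < n, f a i = f b i) ∧ ∃ i < n + 1, f a i ≠ f b i := by
    classical
    intro a b hab
    have h1 : ∃ n, f a n ≠ f b n := Function.ne_iff.1 (f.injective.ne hab)
    exact ⟨Nat.find h1, fun i hi => not_not.1 (Nat.find_min h1 hi), Nat.find h1, Nat.lt_succ_self _,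
      Nat.find_spec h1⟩
  refine ⟨f.trans g.symm, (f.trans g.symm).bijective, C * C' / ρ, by positivity, fun a b => ?_⟩
  by_cases hab : a = b
  · simp [hab]
  obtain ⟨n, h1, h2⟩ := key a b hab
  have hga : ∀ a, g ((f.trans g.symm) a) = f a := fun a => by simp
  have h3 := (hf a b n).1 h1
  have h4 := (hf a b (n + 1)).2 h2
  have h5 := (hg ((f.trans g.symm) a) ((f.trans g.symm) b) n).1 (by simpa only [hga] using h1)
  have h6 := (hg ((f.trans g.symm) a) ((f.trans g.symm) b) (n + 1)).2
    (by simpa only [hga] using h2)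
  rw [pow_succ] at h4 h6
  constructor
  · rw [inv_div, div_mul_eq_mul_div, div_le_iff₀ (by positivity)]
    calc ρ * dist a b ≤ ρ * (C * ρ ^ n) := by gcongr
      _ = C * (ρ ^ n * ρ) := by ring
      _ ≤ C * (C' * dist ((f.trans g.symm) a) ((f.trans g.symm) b)) := by gcongr
      _ = _ := by ring
  · rw [div_mul_eq_mul_div, le_div_iff₀ hρ]
    calc _ ≤ C' * ρ ^ n * ρ := by gcongr
      _ = C' * (ρ ^ n * ρ) := by ring
      _ ≤ C' * (C * dist a b) := by gcongr
      _ = _ := by ring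

/-! ### The cell system of a self-similar set -/

namespace SimilarIFS

variable {d N : ℕ} {r : ℝ} (S : SimilarIFS d N r) {K : Set (EuclideanSpace ℝ (Fin d))}

theorem dist_map (hr : 0 < r) (j : Fin N) (x y : EuclideanSpace ℝ (Fin d)) :
    dist (S.map j x) (S.map j y) = r * dist x y := by
  rw [map, map, dist_add_right, dist_smul₀, (S.rot j).dist_map, Real.norm_of_nonneg hr.le]

theorem dist_wordMap (hr : 0 < r) (w : List (Fin N)) (x y : EuclideanSpace ℝ (Fin d)) :
    dist (S.wordMap w x) (S.wordMap w y) = r ^ w.length * dist x y := by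
  induction w with
  | nil => simp [wordMap]
  | cons j w ih =>
    simp only [wordMap, Function.comp_apply, dist_map S hr, ih, List.length_cons]
    ring

theorem continuous_wordMap (hr : 0 < r) (w : List (Fin N)) : Continuous (S.wordMap w) :=
  (LipschitzWith.of_dist_le_mul (K := ⟨r ^ w.length, by positivity⟩) fun x y =>
    (S.dist_wordMap hr w x y).le).continuous

variable {S}

theorem dist_le_of_mem_cell (hr : 0 < r) (hK : Bornology.IsBounded K) (w : List (Fin N))
    {a b : EuclideanSpace ℝ (Fin d)} (ha : a ∈ S.cell K w) (hb : b ∈ S.cell K w) :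
    dist a b ≤ Metric.diam K * r ^ w.length := by
  obtain ⟨x, hx, rfl⟩ := ha
  obtain ⟨y, hy, rfl⟩ := hb
  rw [S.dist_wordMap hr, mul_comm]
  gcongr
  exact Metric.dist_le_diam_of_mem hK hx hy

theorem IsSelfSimilarSet.cell_eq_iUnion (hK : S.IsSelfSimilarSet K) (w : List (Fin N)) :
    S.cell K w = ⋃ j, S.cell K (w ++ [j]) := by
  have h : ∀ j, S.cell K (w ++ [j]) = S.wordMap w '' (S.map j '' K) := fun j => by
    rw [cell, wordMap_append, Set.image_comp]
    rfl
  simp only [h]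
  rw [← Set.image_iUnion, ← hK.eq_iUnion, cell]

theorem isVerticalEdge_augmentedTree (hK : S.IsSelfSimilarSet K) (w : List (Fin N)) :
    {y | (augmentedTree hK).IsVerticalEdge w y} = Set.range fun j => w ++ [j] := by
  ext y
  simp only [AugmentedTree.IsVerticalEdge, augmentedTree, Set.mem_ofPred_eq, Set.mem_range]
  constructor
  · rintro ⟨hy, rfl⟩
    exact ⟨y.getLast hy, List.dropLast_append_getLast hy⟩
  · rintro ⟨j, rfl⟩
    simp

theorem append_singleton_injective {α : Type} (w : List α) :
    Function.Injective fun j => w ++ [j] := fun j k h => by simpa using h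

theorem isCellSystem_augmentedTree (hr : 0 < r) (hK : S.IsSelfSimilarSet K) {c : ℝ}
    (hc : ∀ n : ℕ, 1 ≤ n → ∀ u v : List (Fin N), u.length = n → v.length = n →
      Disjoint (S.cell K u) (S.cell K v) →
      ∀ x ∈ S.cell K u, ∀ y ∈ S.cell K v, c * r ^ n ≤ dist x y) :
    IsCellSystem (augmentedTree hK) (S.cell K) N r (Metric.diam K) c where
  finite_offspring w := by
    rw [isVerticalEdge_augmentedTree]
    exact Set.finite_range _
  ncard_offspring w _ := by
    rw [isVerticalEdge_augmentedTree, Set.ncard_range_of_injective (append_singleton_injective w),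
      Nat.card_fin]
  isCompact w := hK.isCompact.image (S.continuous_wordMap hr w)
  nonempty w := hK.nonempty.image _
  cell_eq w := by
    rw [isVerticalEdge_augmentedTree, Set.biUnion_range]
    exact hK.cell_eq_iUnion w
  adj_iff _ _ := Iff.rfl
  dist_le w _ _ ha _ hb := dist_le_of_mem_cell hr hK.isCompact.isBounded w ha hb
  le_dist u v hl h2 hd := hc u.length (le_trans one_le_two h2) u v rfl hl.symm hd

end SimilarIFS

/-! ### The cell system of a union of self-similar sets -/

section Union

variable {d N l : ℕ} {r : ℝ} {S : Fin l → SimilarIFS d N r}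
  {K : Fin l → Set (EuclideanSpace ℝ (Fin d))}

/-- The sets that belong to the vertices of the union augmented tree. -/
def unionCell (S : Fin l → SimilarIFS d N r) (K : Fin l → Set (EuclideanSpace ℝ (Fin d))) :
    Option (Fin l × List (Fin N)) → Set (EuclideanSpace ℝ (Fin d))
  | none => ⋃ i, K i
  | some (i, w) => (S i).cell (K i) w

theorem isVerticalEdge_unionAugmentedTree_none (hK : ∀ i, (S i).IsSelfSimilarSet (K i)) :
    {y | (unionAugmentedTree hK).IsVerticalEdge none y} = Set.range fun i => some (i, []) := by
  ext y
  simp only [AugmentedTree.IsVerticalEdge, unionAugmentedTree, Set.mem_ofPred_eq, Set.mem_range]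
  rcases y with _ | ⟨i, _ | ⟨j, w⟩⟩ <;> simp [unionPred]

theorem isVerticalEdge_unionAugmentedTree_some (hK : ∀ i, (S i).IsSelfSimilarSet (K i)) (i : Fin l)
    (w : List (Fin N)) : {y | (unionAugmentedTree hK).IsVerticalEdge (some (i, w)) y} =
      Set.range fun j => some (i, w ++ [j]) := by
  ext y
  simp only [AugmentedTree.IsVerticalEdge, unionAugmentedTree, Set.mem_ofPred_eq, Set.mem_range]
  rcases y with _ | ⟨i', _ | ⟨j, v⟩⟩
  · simp
  · simp [unionPred]
  · simp only [ne_eq, reduceCtorEq, not_false_eq_true, true_and, unionPred, Option.some.injEq,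
      Prod.mk.injEq]
    constructor
    · rintro ⟨rfl, rfl⟩
      exact ⟨(j :: v).getLast (by simp), rfl, List.dropLast_append_getLast _⟩
    · rintro ⟨k, rfl, h⟩
      rw [← h]
      simp

/-- The level of a vertex exceeds the length of its word by 1, so both constants are divided by `r`,
and words of length at least 1 are the vertices of level at least 2. -/
theorem isCellSystem_unionAugmentedTree [Nonempty (Fin l)] (hr : 0 < r)
    (hK : ∀ i, (S i).IsSelfSimilarSet (K i)) {c : ℝ}
    (hc : ∀ n : ℕ, 1 ≤ n → ∀ i j : Fin l, ∀ u v : List (Fin N),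
      u.length = n → v.length = n → Disjoint ((S i).cell (K i) u) ((S j).cell (K j) v) →
      ∀ x ∈ (S i).cell (K i) u, ∀ y ∈ (S j).cell (K j) v, c * r ^ n ≤ dist x y) :
    IsCellSystem (unionAugmentedTree hK) (unionCell S K) N r ((∑ i, Metric.diam (K i)) / r)
      (c / r) where
  finite_offspring x := by
    rcases x with _ | ⟨i, w⟩
    · rw [isVerticalEdge_unionAugmentedTree_none]
      exact Set.finite_range _
    · rw [isVerticalEdge_unionAugmentedTree_some]
      exact Set.finite_range _
  ncard_offspring x hx := by
    rcases x with _ | ⟨i, w⟩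
    · exact absurd rfl hx
    · rw [isVerticalEdge_unionAugmentedTree_some, Set.ncard_range_of_injective, Nat.card_fin]
      exact fun j k h => by simpa using h
  isCompact x := by
    rcases x with _ | ⟨i, w⟩
    · exact isCompact_iUnion fun i => (hK i).isCompact
    · exact (hK i).isCompact.image ((S i).continuous_wordMap hr w)
  nonempty x := by
    rcases x with _ | ⟨i, w⟩
    · exact Set.nonempty_iUnion.2 ⟨Classical.arbitrary _, (hK _).nonempty⟩
    · exact (hK i).nonempty.image _
  cell_eq x := by
    rcases x with _ | ⟨i, w⟩
    · rw [isVerticalEdge_unionAugmentedTree_none, Set.biUnion_range]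
      refine Set.iUnion_congr fun i => ?_
      exact (Set.image_id (K i)).symm
    · rw [isVerticalEdge_unionAugmentedTree_some, Set.biUnion_range]
      exact (hK i).cell_eq_iUnion w
  adj_iff x y := by
    constructor
    · rintro ⟨i, u, j, v, rfl, rfl, hl, hne, h⟩
      exact ⟨congrArg (· + 1) hl, hne, h⟩
    · rintro ⟨hl, hne, h⟩
      rcases x with _ | ⟨i, u⟩ <;> rcases y with _ | ⟨j, v⟩
      · exact absurd rfl hne
      · exact absurd hl.symm (Nat.succ_ne_zero _)
      · exact absurd hl (Nat.succ_ne_zero _)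
      · exact ⟨i, u, j, v, rfl, rfl, Nat.succ_injective hl, hne, h⟩
  dist_le x hx a ha b hb := by
    rcases x with _ | ⟨i, w⟩
    · exact absurd rfl hx
    · refine (SimilarIFS.dist_le_of_mem_cell hr (hK i).isCompact.isBounded w ha hb).trans ?_
      change _ ≤ (∑ i, Metric.diam (K i)) / r * r ^ (w.length + 1)
      rw [pow_succ', ← mul_assoc, div_mul_cancel₀ _ hr.ne']
      gcongr
      exact Finset.single_le_sum (f := fun i => Metric.diam (K i)) (fun _ _ => Metric.diam_nonneg)
        (Finset.mem_univ i)
  le_dist x y hl h2 hd a ha b hb := by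
    rcases x with _ | ⟨i, u⟩ <;> rcases y with _ | ⟨j, v⟩
    · exact absurd h2 (by simp [unionAugmentedTree, unionLevel])
    · exact absurd hl.symm (Nat.succ_ne_zero _)
    · exact absurd hl (Nat.succ_ne_zero _)
    · change c / r * r ^ (u.length + 1) ≤ _
      rw [pow_succ', ← mul_assoc, div_mul_cancel₀ _ hr.ne']
      exact hc u.length (Nat.le_of_succ_le_succ h2) i j u v rfl (Nat.succ_injective hl).symm hd
        a ha b hb

end Union

/-! ### The theorem -/

theorem corollary5p2 {d N l : ℕ} (hN : 2 ≤ N) {r : ℝ} (hr0 : 0 < r) (hr1 : r < 1)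
    (S : Fin l → SimilarIFS d N r) (K : Fin l → Set (EuclideanSpace ℝ (Fin d)))
    (hK : ∀ i, (S i).IsSelfSimilarSet (K i))
    (hH : ∀ i, (S i).ConditionH)
    (hsimple : ∀ i, (SimilarIFS.augmentedTree (hK i)).IsSimple)
    (hUH : UnionConditionH S K)
    (hUsimple : (unionAugmentedTree hK).IsSimple) :
    ∀ j, LipschitzEquivalent (⋃ i, K i) (K j) := by
  intro j
  have : Nonempty (Fin l) := ⟨j⟩
  obtain ⟨c, hc, hcU⟩ := hUH
  have h1 := isCellSystem_unionAugmentedTree hr0 hK hcU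
  -- The separation of the cells of `K j` is the case of equal indices in the union condition.
  have h2 := SimilarIFS.isCellSystem_augmentedTree hr0 (hK j) fun n hn => hcU n hn j j
  obtain ⟨P, hP, hf⟩ := h1.exists_coding hN hr0 hr1
    (div_nonneg (Finset.sum_nonneg fun _ _ => Metric.diam_nonneg) hr0.le) (div_pos hc hr0) hUsimple
  obtain ⟨Q, hQ, hg⟩ := h2.exists_coding hN hr0 hr1 Metric.diam_nonneg hc (hsimple j)
  -- Taking each period as the multiplier of the other gives both codings the alphabet size `N ^ (P
  -- * Q)` and the ratio `r ^ (P * Q)`.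
  obtain ⟨f, C, hC, hfC⟩ := hf Q hQ
  specialize hg P hP
  rw [mul_comm Q P] at hg
  obtain ⟨g, C', hC', hgC⟩ := hg
  have hcell : (S j).cell (K j) (SimilarIFS.augmentedTree (hK j)).root = K j := Set.image_id _
  have h3 := LipschitzEquivalent.of_codings (pow_pos hr0 _) hC hC' hfC hgC
  rw [hcell] at h3
  exact h3
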